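/- Let $\vartheta_2(\tau)=\sum_{n\in\mathbb Z}e^{\pi i(n+1/2)^2\tau}$, $\vartheta_3(\tau)=\sum_{n\in\mathbb Z}e^{\pi i n^2\tau}$, $\vartheta_4(\tau)=\sum_{n\in\mathbb Z}(-1)^ne^{\pi i n^2\tau}$ for $\tau\in\mathbb H$, the upper half-plane, and let $$\chi(\tau)=-\frac{\vartheta_4(\tau/2)}{\vartheta_3(\tau/2)},\qquad \varphi(\tau)=-\frac{\vartheta_4(\tau)}{\vartheta_3(\tau/2)}\cdot\frac{\vartheta_2^2(\tau/2)}{\vartheta_3^2(\tau/2)}$$ be Burnside's functions. They are holomorphic on $\mathbb H$ and $x=\chi(\tau)$, $y=\varphi(\tau)$ satisfy Burnside's equation $y^2=x^5-x$ identically. For $f:\mathbb H\to\mathbb C$ let $\mathrm{Aut}(f)$ be the group of all $g\in \mathrm{PSL}_2(\mathbb R)$ with $f(g\tau)=f(\tau)$ for all $\tau\in\mathbb H$. The group uniformizing Burnside's curve is $\mathfrak G=\mathrm{Aut}(\chi)\cap\mathrm{Aut}(\varphi)$. Let $\Gamma(4)\subset\mathrm{PSL}_2(\mathbb R)$ be the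 principal congruence subgroup of level $4$ (the image of the kernel of $\mathrm{SL}_2(\mathbb Z)\to\mathrm{SL}_2(\mathbb Z/4)$). All matrices below stand for their classes in $\mathrm{PSL}_2(\mathbb R)$. (a) $\Gamma(4)$ is freely generated by $$V_0=\begin{pmatrix}1&4\\0&1\end{pmatrix},\ V_1=\begin{pmatrix}1&0\\-4&1\end{pmatrix},\ V_2=\begin{pmatrix}3&-4\\4&-5\end{pmatrix},\ V_3=\begin{pmatrix}7&-16\\4&-9\end{pmatrix},\ V_4=\begin{pmatrix}11&-36\\4&-13\end{pmatrix}.$$ (b) $\mathfrak G$ is a subgroup of index $2$ in $\Gamma(4)$. It is free of rank $9$, freely generated by $T_0=V_0^2$, $T_k=V_0V_k$ and $T_{k+4}=V_0V_k^{-1}$ ($k=1,\dots,4$), that is, by $$T_0=\begin{pmatrix}1&8\\0&1\end{pmatrix},\ T_1=\begin{pmatrix}15&-4\\4&-1\end{pmatrix},\ T_2=\begin{pmatrix}19&-24\\4&-5\end{pmatrix},\ T_3=\begin{pmatrix}23&-52\\4&-9\end{pmatrix},\ T_4=\begin{pmatrix}27&-88\\4&-13\end{pmatrix},$$ $$T_5=\begin{pmatrix}17&4\\4&1\end{pmatrix},\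 T_6=\begin{pmatrix}21&-16\\4&-3\end{pmatrix},\ T_7=\begin{pmatrix}25&-44\\4&-7\end{pmatrix},\ T_8=\begin{pmatrix}29&-80\\4&-11\end{pmatrix}.$$ (c) $\mathrm{Aut}(\varphi)=\mathfrak G$. (d) Let $\mathcal P$ be the closed hyperbolic $18$-gon with ideal vertices $\infty,-\tfrac12,0,\tfrac12,1,\dots,\tfrac{15}2$, that is, the part of the strip $-\tfrac12\le\mathrm{Re}\,\tau\le\tfrac{15}2$ lying outside the open half-discs with diameters $[\tfrac{i-1}2,\tfrac i2]$, $i=0,\dots,15$. Then $\mathcal P$ is a fundamental region of $\mathfrak G$: it is the closure of its nonempty interior, its translates under $\mathfrak G$ cover $\mathbb H$, and the interiors of $\mathcal P$ and $g\mathcal P$ are disjoint for $1\ne g\in\mathfrak G$. Moreover $\mathcal P=\mathcal P_x\cup V_0(\mathcal P_x)$, where $\mathcal P_x$ is the ideal $10$-gon defined in the same way with vertices $\infty,-\tfrac12,0,\dots,\tfrac72$, and $T_0,\dots,T_8$ identify the $18$ sides of $\mathcal P$ in pairs: writing $s_i$ for the side over $[\tfrac{i-1}2,\tfrac i2]$,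 $T_0$ maps the side $\mathrm{Re}\,\tau=-\tfrac12$ onto the side $\mathrm{Re}\,\tau=\tfrac{15}2$, and $T_k(s_{2k-1})=s_{2k+6}$, $T_{k+4}(s_{2k-2})=s_{2k+7}$ for $k=1,\dots,4$. -/

import Mathlib

open UpperHalfPlane
open scoped MatrixGroups Pointwise

/-! ### Theta constants and the parametrization -/

/-- `ϑ₂(τ) = ∑_{n ∈ ℤ} exp (π i (n + 1/2)² τ) = exp (π i τ / 4) ∑_{n ∈ ℤ} exp (π i (n² + n) τ)`. -/
noncomputable def theta2 (τ : ℂ) : ℂ :=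
  Complex.exp (Real.pi * Complex.I * τ / 4) * jacobiTheta₂ (τ / 2) τ

/-- `ϑ₃(τ) = ∑_{n ∈ ℤ} exp (π i n² τ)`. -/
noncomputable def theta3 (τ : ℂ) : ℂ := jacobiTheta₂ 0 τ

/-- `ϑ₄(τ) = ∑_{n ∈ ℤ} (-1)ⁿ exp (π i n² τ)`. -/
noncomputable def theta4 (τ : ℂ) : ℂ := jacobiTheta₂ (1 / 2) τ

/-- Burnside's function `x = χ(τ)`. -/
noncomputable def burnsideX (τ : ℂ) : ℂ := -(theta4 (τ / 2) / theta3 (τ / 2))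

/-- Burnside's function `y = φ(τ) = -(k')^(1/4) k` at `τ / 2`, a single-valued square root of
`x⁵ - x`. Here `k = ϑ₂² / ϑ₃²` and `k' = ϑ₄² / ϑ₃²` are Legendre's moduli, and
`(k')^(1/4)` at `τ / 2` is `ϑ₄(τ) / ϑ₃(τ / 2)`. -/
noncomputable def burnsideY (τ : ℂ) : ℂ :=
  -(theta4 τ / theta3 (τ / 2) * (theta2 (τ / 2) ^ 2 / theta3 (τ / 2) ^ 2))

/-! ### Groups of Möbius transformations of the upper half-plane -/

/-- `PSL(2, ℝ)` acts on `ℍ` by `τ ↦ (a τ + b) / (c τ + d)`. -/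
noncomputable instance pslActionUpperHalfPlane : MulAction PSL(2, ℝ) ℍ :=
  MulAction.compHom ℍ
    (Matrix.ProjectiveSpecialLinearGroup.toPGL : PSL(2, ℝ) →* PGL(2, ℝ))

/-- The action of the class of a matrix is the action of the matrix. -/
theorem psl_mk_smul (g : SL(2, ℝ)) (τ : ℍ) : (QuotientGroup.mk g : PSL(2, ℝ)) • τ = g • τ := rfl

/-- The transformation in `PSL(2, ℝ)` given by an integral matrix of determinant one. -/
noncomputable def slToPSL : SL(2, ℤ) →* PSL(2, ℝ) :=
  (QuotientGroup.mk' (Subgroup.center SL(2, ℝ))).comp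
    (Matrix.SpecialLinearGroup.map (Int.castRingHom ℝ))

/-- The automorphism group of a function `f` on `ℍ`: all `g` in `PSL(2, ℝ)` with `f ∘ g = f`. -/
def automorphismGroup (f : ℍ → ℂ) : Subgroup PSL(2, ℝ) where
  carrier := {g | ∀ τ : ℍ, f (g • τ) = f τ}
  one_mem' := fun τ => by rw [one_smul]
  mul_mem' := fun {g h} hg hh τ => by rw [mul_smul, hg, hh]
  inv_mem' := fun {g} hg τ => by
    have h := hg (g⁻¹ • τ)
    rw [smul_inv_smul] at h
    exact h.symm

/-- The group uniformizing `y² = x⁵ - x` by Burnside's functions: the group of all transformations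
that leave both `χ` and `φ` invariant. -/
noncomputable def burnsideGroup : Subgroup PSL(2, ℝ) :=
  automorphismGroup (fun τ : ℍ => burnsideX τ) ⊓ automorphismGroup (fun τ : ℍ => burnsideY τ)

/-- The principal congruence subgroup of level 4, as a group of transformations. -/
noncomputable def gammaFour : Subgroup PSL(2, ℝ) := (CongruenceSubgroup.Gamma 4).map slToPSL

/-- The matrices of `V₀, …, V₄`. -/
def matrixV : Fin 5 → SL(2, ℤ) :=
  ![⟨!![1, 4; 0, 1], by norm_num [Matrix.det_fin_two_of]⟩,
    ⟨!![1, 0; -4, 1], by norm_num [Matrix.det_fin_two_of]⟩,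
    ⟨!![3, -4; 4, -5], by norm_num [Matrix.det_fin_two_of]⟩,
    ⟨!![7, -16; 4, -9], by norm_num [Matrix.det_fin_two_of]⟩,
    ⟨!![11, -36; 4, -13], by norm_num [Matrix.det_fin_two_of]⟩]

/-- The matrices of `T₀, …, T₈`. -/
def matrixT : Fin 9 → SL(2, ℤ) :=
  ![⟨!![1, 8; 0, 1], by norm_num [Matrix.det_fin_two_of]⟩,
    ⟨!![15, -4; 4, -1], by norm_num [Matrix.det_fin_two_of]⟩,
    ⟨!![19, -24; 4, -5], by norm_num [Matrix.det_fin_two_of]⟩,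
    ⟨!![23, -52; 4, -9], by norm_num [Matrix.det_fin_two_of]⟩,
    ⟨!![27, -88; 4, -13], by norm_num [Matrix.det_fin_two_of]⟩,
    ⟨!![17, 4; 4, 1], by norm_num [Matrix.det_fin_two_of]⟩,
    ⟨!![21, -16; 4, -3], by norm_num [Matrix.det_fin_two_of]⟩,
    ⟨!![25, -44; 4, -7], by norm_num [Matrix.det_fin_two_of]⟩,
    ⟨!![29, -80; 4, -11], by norm_num [Matrix.det_fin_two_of]⟩]

/-- The transformations `V₀, …, V₄`. -/
noncomputable def genV (i : Fin 5) : PSL(2, ℝ) := slToPSL (matrixV i)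

/-- The transformations `T₀, …, T₈`. -/
noncomputable def genT (i : Fin 9) : PSL(2, ℝ) := slToPSL (matrixT i)

/-- The family `g` is a free basis of the subgroup `H` (so `H` is free of rank `|ι|`). -/
def FreelyGenerates {ι G : Type*} [Group G] (g : ι → G) (H : Subgroup G) : Prop :=
  Function.Injective (FreeGroup.lift g) ∧ Subgroup.closure (Set.range g) = H

/-! ### Ideal polygons and fundamental regions -/

/-- The geodesic with end points `a < b` on the real axis. -/
def geodesicArc (a b : ℝ) : Set ℍ := {τ | ‖(τ : ℂ) - ((a + b) / 2 : ℝ)‖ = (b - a) / 2}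

/-- The geodesic with end points `a` and `∞`. -/
def geodesicRay (a : ℝ) : Set ℍ := {τ | τ.re = a}

/-- The closed hyperbolic polygon with the `n + 2` ideal vertices `∞, v 0 < v 1 < ⋯ < v n`: the
part of the strip `v 0 ≤ Re τ ≤ v n` outside the half-discs over the segments
`[v i, v (i + 1)]`. Its `n + 2` sides are two rays and `n` arcs. -/
def idealPolygon {n : ℕ} (v : Fin (n + 1) → ℝ) : Set ℍ :=
  {τ | v 0 ≤ τ.re ∧ τ.re ≤ v (Fin.last n) ∧ ∀ i : Fin n,
    (v i.succ - v i.castSucc) / 2 ≤ ‖(τ : ℂ) - ((v i.castSucc + v i.succ) / 2 : ℝ)‖}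

/-- The points `-1/2, 0, 1/2, 1, …`. -/
noncomputable def halfPoint (i : ℕ) : ℝ := ((i : ℝ) - 1) / 2

/-- The ideal 10-gon with vertices `∞, -1/2, 0, 1/2, …, 7/2`. -/
def tenGon : Set ℍ := idealPolygon (n := 8) fun i => halfPoint i

/-- The ideal 18-gon with vertices `∞, -1/2, 0, 1/2, …, 15/2`. -/
def eighteenGon : Set ℍ := idealPolygon (n := 16) fun i => halfPoint i

/-- The side of these polygons over the segment `[(i - 1) / 2, i / 2]`. -/
def arcSide (i : ℕ) : Set ℍ := geodesicArc (halfPoint i) (halfPoint (i + 1))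

/-- A fundamental region of a group of transformations: a closed region, the closure of its
nonempty interior, whose translates cover `ℍ` and have pairwise disjoint interiors. -/
def IsFundamentalRegion (G : Subgroup PSL(2, ℝ)) (D : Set ℍ) : Prop :=
  (interior D).Nonempty ∧ closure (interior D) = D ∧ (⋃ g ∈ G, g • D) = Set.univ ∧
    ∀ g ∈ G, g ≠ 1 → Disjoint (interior D) (g • interior D)

/-! ### Theta constants: duplication formulas -/

/-! Everything is read off from w = ϑ₂(2τ)/ϑ₃(2τ), `octahedralW`. The duplication formulas give x =
-(1 - w)/(1 + w) and y² = 8(w - w⁵)/(1 + w)⁶. The generators T and S of the modular group act on w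
by the octahedral rotations w ↦ iw and w ↦ (1 - w)/(1 + w), and w omits the six vertices 0, ∞, ±1,
±i. In particular y has no zeros on ℍ, so its sign can be followed by continuity.

Sign character. T⁴ fixes w and negates y. The modular group permutes the fibres of w and multiplies
y by functions of w (`isCompatible`), so every conjugate of T⁴ also fixes w and negates y. The `genV
i` are such conjugates, and a Euclidean descent on the lower left entry shows that they generate
Γ(4) (`mem_closure_genV_of_dvd`). Hence Γ(4) fixes x, and a word in the V's multiplies y by the
parity sign of its length. The words of even length are generated by the `genT i` and have index 2.

Freeness and polygons. Both families pair the sides of an ideal polygon: a translation pairs the two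
rays, and matrices with lower left entry ±4 pair the isometric circles over the half-unit segments.
A single ping-pong argument (`disjoint_interior_halfPolygon`) gives freeness and the disjointness of
the translated interiors. Covering follows by choosing a point of greatest imaginary part in a
Γ(4)-orbit; two copies of the 10-gon make the 18-gon.

Aut(φ) ⊆ Γ(4) (`automorphismGroup_burnsideY_le`). Here g is an arbitrary real matrix with y ∘ g = y.
Up the imaginary axis y tends to 0, so x ∘ g approaches the vertices of the octahedron and the
octahedral invariant of w ∘ g blows up. This invariant is modular and bounded on truncated
fundamental domains, so g carries the upper part of the axis into one modular horoball, and γg fixes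
∞ for some modular γ (`exists_upper_triangular`). By the cosets of ±Γ(4), x ∘ g then tends at i∞ to
0, to a fourth root of unity, or to ∞. The leading terms w ~ 2q and y² ~ 16q in q = exp(πiτ/2)
exclude the first case, since the ratio 8 is not 1. Boundedness of y² excludes the last. The middle
case forces a translation by a multiple of 4, and thus g ∈ Γ(4). Consequently Aut(φ) is the group of
even words, and it lies in Aut(χ). -/

theorem HasSum.add_of_isCompl_range {α β γ : Type*} {f : γ → ℂ} {u : α → γ} {v : β → γ} {a b : ℂ}
    (hu : Function.Injective u) (hv : Function.Injective v)
    (huv : IsCompl (Set.range u) (Set.range v)) {g : α → ℂ} {h : β → ℂ} (ha : HasSum g a)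
    (hb : HasSum h b) (hg : ∀ x, f (u x) = g x) (hh : ∀ x, f (v x) = h x) : HasSum f (a + b) := by
  obtain rfl : f ∘ u = g := funext hg
  obtain rfl : f ∘ v = h := funext hh
  exact HasSum.add_isCompl huv (hu.hasSum_range_iff.2 ha) (hv.hasSum_range_iff.2 hb)

theorem isCompl_range_two_mul :
    IsCompl (Set.range fun n : ℤ => 2 * n) (Set.range fun n : ℤ => 2 * n + 1) := by
  refine isCompl_iff.2 ⟨Set.disjoint_left.2 ?_, codisjoint_iff.2 (Set.eq_univ_of_forall ?_)⟩
  · rintro _ ⟨m, rfl⟩ ⟨n, h⟩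
    simp only at h
    omega
  · intro n
    rcases Int.even_or_odd' n with ⟨k, h | h⟩
    · exact Or.inl ⟨k, h.symm⟩
    · exact Or.inr ⟨k, h.symm⟩

/-- Pairs of integers split by the parity of their sum; this reindexing of a double theta series is
what doubles τ. -/
theorem isCompl_range_add_sub :
    IsCompl (Set.range fun p : ℤ × ℤ => (p.1 + p.2, p.1 - p.2))
      (Set.range fun p : ℤ × ℤ => (p.1 + p.2 + 1, p.1 - p.2)) := by
  refine isCompl_iff.2 ⟨Set.disjoint_left.2 ?_, codisjoint_iff.2 (Set.eq_univ_of_forall ?_)⟩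
  · rintro _ ⟨m, rfl⟩ ⟨n, h⟩
    simp only [Prod.mk.injEq] at h
    omega
  · rintro ⟨m, n⟩
    rcases Int.even_or_odd' (m + n) with ⟨k, h | h⟩
    · exact Or.inl ⟨(k, k - n), by simp only [Prod.mk.injEq]; omega⟩
    · exact Or.inr ⟨(k, k - n), by simp only [Prod.mk.injEq]; omega⟩

theorem summable_norm_jacobiTheta₂_term (z : ℂ) {τ : ℂ} (hτ : 0 < τ.im) :
    Summable fun n => ‖jacobiTheta₂_term n z τ‖ :=
  ((summable_jacobiTheta₂_term_iff z τ).2 hτ).norm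

theorem hasSum_mul_of_summable_norm {f g : ℤ → ℂ} {a b : ℂ} (hf : HasSum f a) (hg : HasSum g b)
    (hf' : Summable fun n => ‖f n‖) (hg' : Summable fun n => ‖g n‖) :
    HasSum (fun p : ℤ × ℤ => f p.1 * g p.2) (a * b) :=
  hf.mul hg (summable_mul_of_summable_norm hf' hg')

theorem hasSum_jacobiTheta₂_mul (z z' : ℂ) {τ : ℂ} (hτ : 0 < τ.im) :
    HasSum (fun p : ℤ × ℤ => jacobiTheta₂_term p.1 z τ * jacobiTheta₂_term p.2 z' τ)
      (jacobiTheta₂ z τ * jacobiTheta₂ z' τ) :=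
  hasSum_mul_of_summable_norm (f := fun n => jacobiTheta₂_term n z τ)
    (g := fun n => jacobiTheta₂_term n z' τ) (hasSum_jacobiTheta₂_term z hτ)
    (hasSum_jacobiTheta₂_term z' hτ) (summable_norm_jacobiTheta₂_term z hτ)
    (summable_norm_jacobiTheta₂_term z' hτ)

/-- The product formula for the two-variable theta function. -/
theorem jacobiTheta₂_mul (z z' : ℂ) {τ : ℂ} (hτ : 0 < τ.im) :
    jacobiTheta₂ z τ * jacobiTheta₂ z' τ =
      jacobiTheta₂ (z + z') (2 * τ) * jacobiTheta₂ (z - z') (2 * τ) +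
        Complex.exp (Real.pi * Complex.I * τ + 2 * Real.pi * Complex.I * z) *
          (jacobiTheta₂ (z + z' + τ) (2 * τ) * jacobiTheta₂ (z - z' + τ) (2 * τ)) := by
  have hτ2 : 0 < (2 * τ).im := by simpa using hτ
  have h1 : Function.Injective fun p : ℤ × ℤ => (p.1 + p.2, p.1 - p.2) := fun p q h => by
    simp only [Prod.mk.injEq] at h
    ext <;> omega
  have h2 : Function.Injective fun p : ℤ × ℤ => (p.1 + p.2 + 1, p.1 - p.2) := fun p q h => by
    simp only [Prod.mk.injEq] at h
    ext <;> omega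
  refine (hasSum_jacobiTheta₂_mul z z' hτ).unique
    (HasSum.add_of_isCompl_range h1 h2 isCompl_range_add_sub
      (hasSum_jacobiTheta₂_mul _ _ hτ2) ((hasSum_jacobiTheta₂_mul _ _ hτ2).mul_left _) ?_ ?_)
  · intro p
    simp only [jacobiTheta₂_term, ← Complex.exp_add]
    push_cast
    ring_nf
  · intro p
    simp only [jacobiTheta₂_term, ← Complex.exp_add]
    push_cast
    ring_nf

/-- Evenness and the two quasi-periods combine into a reflection about this point under which theta
is odd. -/
theorem jacobiTheta₂_half_period (σ : ℂ) : jacobiTheta₂ (1 / 2 + σ / 2) σ = 0 := by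
  have h1 : jacobiTheta₂ (1 / 2 + σ / 2) σ =
      jacobiTheta₂ (-(1 / 2 + σ / 2) + σ) σ := by
    rw [← jacobiTheta₂_add_left (-(1 / 2 + σ / 2) + σ)]
    ring_nf
  rw [jacobiTheta₂_add_left', jacobiTheta₂_neg_left,
    show -(Real.pi : ℂ) * Complex.I * (σ + 2 * -(1 / 2 + σ / 2)) = Real.pi * Complex.I by ring,
    Complex.exp_pi_mul_I] at h1
  linear_combination h1 / 2

theorem theta3_sq {τ : ℂ} (hτ : 0 < τ.im) :
    theta3 τ ^ 2 = theta3 (2 * τ) ^ 2 + theta2 (2 * τ) ^ 2 := by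
  have h := jacobiTheta₂_mul 0 0 hτ
  simp only [add_zero, sub_zero, zero_add, mul_zero] at h
  simp only [theta3, theta2, mul_pow, ← Complex.exp_nat_mul]
  rw [sq, h, show 2 * τ / 2 = τ by ring]
  push_cast
  ring_nf

theorem theta4_sq {τ : ℂ} (hτ : 0 < τ.im) :
    theta4 τ ^ 2 = theta3 (2 * τ) ^ 2 - theta2 (2 * τ) ^ 2 := by
  have h := jacobiTheta₂_mul (1 / 2) (1 / 2) hτ
  have h0 := jacobiTheta₂_add_left 0 (2 * τ)
  have h1 := jacobiTheta₂_add_left τ (2 * τ)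
  rw [show (1 / 2 + 1 / 2 : ℂ) = 0 + 1 by norm_num, sub_self, h0,
    show (0 + 1 + τ : ℂ) = τ + 1 by ring, h1, zero_add, Complex.exp_add,
    show 2 * (Real.pi : ℂ) * Complex.I * (1 / 2) = Real.pi * Complex.I by ring,
    Complex.exp_pi_mul_I] at h
  simp only [theta4, theta3, theta2, mul_pow, ← Complex.exp_nat_mul]
  rw [sq, h, show 2 * τ / 2 = τ by ring]
  push_cast
  ring_nf

/-- In the product formula with arguments 1/2 and 0 the second summand contains theta at its half
period, so only the first survives. -/
theorem theta3_mul_theta4 {τ : ℂ} (hτ : 0 < τ.im) :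
    theta3 τ * theta4 τ = theta4 (2 * τ) ^ 2 := by
  have h := jacobiTheta₂_mul (1 / 2) 0 hτ
  have h0 := jacobiTheta₂_half_period (2 * τ)
  rw [show 2 * τ / 2 = τ by ring] at h0
  rw [add_zero, sub_zero, h0] at h
  rw [theta3, theta4, theta4, mul_comm, h]
  ring

theorem theta2_sq {τ : ℂ} (hτ : 0 < τ.im) :
    theta2 τ ^ 2 = 2 * theta2 (2 * τ) * theta3 (2 * τ) := by
  have h := jacobiTheta₂_mul (τ / 2) (τ / 2) hτ
  have h0 := jacobiTheta₂_add_left' 0 (2 * τ)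
  rw [zero_add] at h0
  rw [show τ / 2 + τ / 2 = τ by ring, sub_self, zero_add, show τ + τ = 2 * τ by ring, h0] at h
  simp only [theta3, theta2, mul_pow, ← Complex.exp_nat_mul]
  rw [sq (jacobiTheta₂ _ _), h, show 2 * τ / 2 = τ by ring, ← mul_assoc (Complex.exp _),
    ← mul_assoc (Complex.exp _), ← Complex.exp_add]
  push_cast
  ring_nf
  simp only [Complex.exp_zero]
  ring_nf

theorem theta3_add_theta2 {τ : ℂ} (hτ : 0 < τ.im) :
    theta3 τ = theta3 (4 * τ) + theta2 (4 * τ) := by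
  have hτ4 : 0 < (4 * τ).im := by simpa using hτ
  refine (hasSum_jacobiTheta₂_term 0 hτ).unique
    (HasSum.add_of_isCompl_range (fun a b h => by simpa using h) (fun a b h => by simpa using h)
      isCompl_range_two_mul (hasSum_jacobiTheta₂_term 0 hτ4)
      ((hasSum_jacobiTheta₂_term (4 * τ / 2) hτ4).mul_left _) ?_ ?_)
  · intro n
    simp only [jacobiTheta₂_term]
    push_cast
    ring_nf
  · intro n
    simp only [jacobiTheta₂_term, ← Complex.exp_add]
    push_cast
    ring_nf

theorem theta4_eq_theta3_add_one (τ : ℂ) : theta4 τ = theta3 (τ + 1) := by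
  refine tsum_congr fun n => ?_
  have h : Complex.exp (Real.pi * Complex.I * (n ^ 2 - n)) = 1 := by
    obtain ⟨k, hk⟩ : ∃ k, n ^ 2 - n = k + k := by
      have := Int.even_mul_pred_self n
      rw [mul_sub, mul_one, ← sq] at this
      exact this
    have hk' : (n : ℂ) ^ 2 - n = k + k := by exact_mod_cast hk
    rw [hk', Complex.exp_eq_one_iff]
    exact ⟨k, by ring⟩
  rw [jacobiTheta₂_term, jacobiTheta₂_term,
    show (2 * Real.pi * Complex.I * n * 0 + Real.pi * Complex.I * n ^ 2 * (τ + 1) : ℂ) =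
      2 * Real.pi * Complex.I * n * (1 / 2) + Real.pi * Complex.I * n ^ 2 * τ +
        Real.pi * Complex.I * (n ^ 2 - n) by ring, Complex.exp_add _ (_ * (_ - _)), h, mul_one]

theorem theta2_add_two (τ : ℂ) : theta2 (τ + 2) = Complex.I * theta2 τ := by
  have h : Complex.exp (Real.pi / 2 * Complex.I) = Complex.I := Complex.exp_pi_div_two_mul_I
  rw [theta2, theta2, jacobiTheta₂_add_right, add_div, div_self two_ne_zero, jacobiTheta₂_add_left,
    show (Real.pi : ℂ) * Complex.I * (τ + 2) / 4 =
      Real.pi / 2 * Complex.I + Real.pi * Complex.I * τ / 4 by ring, Complex.exp_add, h]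
  ring

theorem theta3_add_two (τ : ℂ) : theta3 (τ + 2) = theta3 τ := jacobiTheta₂_add_right _ _

theorem theta4_add_two (τ : ℂ) : theta4 (τ + 2) = theta4 τ := jacobiTheta₂_add_right _ _

theorem theta4_eq_sub {τ : ℂ} (hτ : 0 < τ.im) :
    theta4 τ = theta3 (4 * τ) - theta2 (4 * τ) := by
  rw [theta4_eq_theta3_add_one, theta3_add_theta2 (by simpa using hτ),
    show 4 * (τ + 1) = 4 * τ + 2 + 2 by ring, theta3_add_two, theta3_add_two, theta2_add_two,
    theta2_add_two]
  linear_combination theta2 (4 * τ) * Complex.I_sq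

/-- With a = ϑ₃(2τ) and b = ϑ₂(2τ) this is (a² + b²)² = (2ab)² + (a² - b²)². -/
theorem theta3_pow_four {τ : ℂ} (hτ : 0 < τ.im) :
    theta3 τ ^ 4 = theta2 τ ^ 4 + theta4 τ ^ 4 := by
  linear_combination (theta3 τ ^ 2 + theta3 (2 * τ) ^ 2 + theta2 (2 * τ) ^ 2) * theta3_sq hτ
    - (theta2 τ ^ 2 + 2 * theta2 (2 * τ) * theta3 (2 * τ)) * theta2_sq hτ
    - (theta4 τ ^ 2 + theta3 (2 * τ) ^ 2 - theta2 (2 * τ) ^ 2) * theta4_sq hτ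

/-! ### Behaviour at the cusp and nonvanishing -/

open Filter Topology in
theorem tendsto_jacobiTheta₂_zero :
    Tendsto (fun τ => jacobiTheta₂ 0 τ) (comap Complex.im atTop) (𝓝 1) := by
  have h : ∀ n : ℤ, Tendsto (fun τ => jacobiTheta₂_term n 0 τ) (comap Complex.im atTop)
      (𝓝 (if n = 0 then 1 else 0)) := by
    intro n
    split_ifs with hn
    · simpa [jacobiTheta₂_term, hn] using tendsto_const_nhds
    · rw [tendsto_zero_iff_norm_tendsto_zero]
      simp only [norm_jacobiTheta₂_term, Complex.zero_im, mul_zero, sub_zero]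
      refine Real.tendsto_exp_atBot.comp ?_
      refine Tendsto.const_mul_atTop_of_neg ?_ tendsto_comap
      have : (0 : ℝ) < n ^ 2 := by positivity
      nlinarith [Real.pi_pos]
  -- The series at τ = i dominates all those with Im τ ≥ 1.
  have := tendsto_tsum_of_dominated_convergence (f := fun τ n => jacobiTheta₂_term n 0 τ)
    (bound := fun n => ‖jacobiTheta₂_term n 0 Complex.I‖)
    (summable_norm_jacobiTheta₂_term 0 (by simp)) h ?_
  · simpa [jacobiTheta₂] using this
  · filter_upwards [preimage_mem_comap (Ici_mem_atTop (1 : ℝ))] with τ hτ n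
    simp only [norm_jacobiTheta₂_term, Complex.zero_im, mul_zero, sub_zero, Complex.I_im, mul_one]
    have h1 : (1 : ℝ) ≤ τ.im := hτ
    refine Real.exp_le_exp.2 ?_
    have : (0 : ℝ) ≤ Real.pi * n ^ 2 := by positivity
    nlinarith

-- The norm of the n-th term has exponent proportional to n(n + 1), which vanishes exactly for n = 0
-- and n = -1; these two terms make up the limit 2.
open Filter Topology in
theorem tendsto_jacobiTheta₂_half :
    Tendsto (fun τ => jacobiTheta₂ (τ / 2) τ) (comap Complex.im atTop) (𝓝 2) := by
  have key : ∀ (n : ℤ) (τ : ℂ), ‖jacobiTheta₂_term n (τ / 2) τ‖ =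
      Real.exp (-Real.pi * (n * (n + 1) : ℤ) * τ.im) := by
    intro n τ
    rw [norm_jacobiTheta₂_term]
    congr 1
    simp only [Complex.div_ofNat_im]
    push_cast
    ring
  have hnn : ∀ n : ℤ, 0 ≤ n * (n + 1) := fun n => by
    rcases le_or_gt 0 n with h | h
    · positivity
    · nlinarith
  have h : ∀ n : ℤ, Tendsto (fun τ => jacobiTheta₂_term n (τ / 2) τ) (comap Complex.im atTop)
      (𝓝 ((if n = 0 then 1 else 0) + if n = -1 then 1 else 0)) := by
    intro n
    rcases eq_or_ne n 0 with rfl | h0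
    · simpa [jacobiTheta₂_term] using tendsto_const_nhds
    rcases eq_or_ne n (-1) with rfl | h1
    · have : ∀ τ, jacobiTheta₂_term (-1) (τ / 2) τ = 1 := fun τ => by
        rw [jacobiTheta₂_term, Complex.exp_eq_one_iff]
        exact ⟨0, by push_cast; ring⟩
      simpa [this] using tendsto_const_nhds
    · rw [if_neg h0, if_neg h1, add_zero, tendsto_zero_iff_norm_tendsto_zero]
      simp only [key]
      refine Real.tendsto_exp_atBot.comp ?_
      refine Tendsto.const_mul_atTop_of_neg ?_ tendsto_comap
      have h2 : 0 < n * (n + 1) :=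
        lt_of_le_of_ne (hnn n) (mul_ne_zero h0 (by omega)).symm
      have : (0 : ℝ) < (n * (n + 1) : ℤ) := by exact_mod_cast h2
      nlinarith [Real.pi_pos]
  have := tendsto_tsum_of_dominated_convergence (f := fun τ n => jacobiTheta₂_term n (τ / 2) τ)
    (bound := fun n => ‖jacobiTheta₂_term n (Complex.I / 2) Complex.I‖)
    (summable_norm_jacobiTheta₂_term _ (by simp)) h ?_
  · rw [Summable.tsum_add, tsum_ite_eq, tsum_ite_eq, one_add_one_eq_two] at this
    · exact this
    · exact (hasSum_ite_eq _ _).summable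
    · exact (hasSum_ite_eq _ _).summable
  · filter_upwards [preimage_mem_comap (Ici_mem_atTop (1 : ℝ))] with τ hτ n
    rw [key, key]
    simp only [Complex.I_im, mul_one]
    have h1 : (1 : ℝ) ≤ τ.im := hτ
    refine Real.exp_le_exp.2 ?_
    have : (0 : ℝ) ≤ (n * (n + 1) : ℤ) := by exact_mod_cast hnn n
    have : (0 : ℝ) ≤ Real.pi * (n * (n + 1) : ℤ) := mul_nonneg Real.pi_pos.le this
    nlinarith

open Filter Topology in
/-- A function on `ℍ` with a nonzero limit at `i ∞` whose zero set is stable under `τ ↦ 2 τ` has no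
zeros. -/
theorem ne_zero_of_doubling {f : ℂ → ℂ} {c : ℂ} (hc : c ≠ 0)
    (hf : Tendsto f (comap Complex.im atTop) (𝓝 c))
    (hd : ∀ τ : ℂ, 0 < τ.im → f τ = 0 → f (2 * τ) = 0) {τ : ℂ} (hτ : 0 < τ.im) : f τ ≠ 0 := by
  intro h0
  have him : ∀ n : ℕ, (2 ^ n * τ).im = 2 ^ n * τ.im := fun n => by
    rw [show (2 ^ n * τ : ℂ) = ((2 ^ n : ℝ) : ℂ) * τ by push_cast; rfl,
      Complex.im_ofReal_mul]
  have hz : ∀ n : ℕ, f (2 ^ n * τ) = 0 := by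
    intro n
    induction n with
    | zero => simpa using h0
    | succ n ih =>
      rw [pow_succ', mul_assoc]
      exact hd _ (by rw [him]; positivity) ih
  have hlim : Tendsto (fun n : ℕ => 2 ^ n * τ) atTop (comap Complex.im atTop) := by
    rw [tendsto_comap_iff]
    simp only [Function.comp_def, him]
    exact (tendsto_pow_atTop_atTop_of_one_lt one_lt_two).atTop_mul_const hτ
  have := (hf.comp hlim).congr (f₂ := fun _ => 0) fun n => hz n
  exact hc (tendsto_nhds_unique this tendsto_const_nhds)

-- By the formula for ϑ₃(τ)ϑ₄(τ), a zero of ϑ₄ at τ produces one at 2τ, hence zeros running up to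
-- i∞, where the limit is 1.
open Filter Topology in
theorem theta4_ne_zero {τ : ℂ} (hτ : 0 < τ.im) : theta4 τ ≠ 0 := by
  refine ne_zero_of_doubling one_ne_zero ?_ ?_ hτ
  · rw [funext theta4_eq_theta3_add_one]
    refine tendsto_jacobiTheta₂_zero.comp (tendsto_comap_iff.2 ?_)
    simpa [Function.comp_def] using tendsto_comap
  · intro τ hτ h
    have := theta3_mul_theta4 hτ
    rw [h, mul_zero] at this
    exact pow_eq_zero_iff two_ne_zero |>.1 this.symm

theorem theta3_ne_zero {τ : ℂ} (hτ : 0 < τ.im) : theta3 τ ≠ 0 := by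
  intro h
  have := theta3_mul_theta4 hτ
  rw [h, zero_mul] at this
  exact theta4_ne_zero (by simpa using hτ) (pow_eq_zero_iff two_ne_zero |>.1 this.symm)

theorem theta2_eq_zero_iff (τ : ℂ) : theta2 τ = 0 ↔ jacobiTheta₂ (τ / 2) τ = 0 := by
  simp [theta2]

theorem theta2_ne_zero {τ : ℂ} (hτ : 0 < τ.im) : theta2 τ ≠ 0 := by
  rw [Ne, theta2_eq_zero_iff]
  refine ne_zero_of_doubling two_ne_zero tendsto_jacobiTheta₂_half ?_ hτ
  intro τ hτ h
  rw [← theta2_eq_zero_iff] at h ⊢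
  have := theta2_sq hτ
  rw [h] at this
  simpa [theta3_ne_zero (τ := 2 * τ) (by simpa using hτ)] using this

/-! ### Differentiability -/

theorem differentiableAt_theta2 {τ : ℂ} (hτ : 0 < τ.im) : DifferentiableAt ℂ theta2 τ := by
  refine DifferentiableAt.mul (by fun_prop) ?_
  exact (hasFDerivAt_jacobiTheta₂ (τ / 2) hτ).differentiableAt.comp τ
    (f := fun τ => (τ / 2, τ)) (g := fun p : ℂ × ℂ => jacobiTheta₂ p.1 p.2) (by fun_prop)

theorem differentiableAt_theta3 {τ : ℂ} (hτ : 0 < τ.im) : DifferentiableAt ℂ theta3 τ :=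
  differentiableAt_jacobiTheta₂_snd 0 hτ

theorem differentiableAt_theta4 {τ : ℂ} (hτ : 0 < τ.im) : DifferentiableAt ℂ theta4 τ :=
  differentiableAt_jacobiTheta₂_snd (1 / 2) hτ

/-! ### Burnside's functions as functions of the octahedral Hauptmodul -/

/-- The Hauptmodul `ϑ₂(2τ) / ϑ₃(2τ)` of `Γ(4)` that vanishes at `i ∞`. -/
noncomputable def octahedralW (τ : ℂ) : ℂ := theta2 (2 * τ) / theta3 (2 * τ)

section Pointwise

variable {τ : ℂ} (hτ : 0 < τ.im)
include hτ

theorem two_mul_im_pos : 0 < (2 * τ).im := by simpa using hτ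

theorem half_im_pos : 0 < (τ / 2).im := by simpa using hτ

theorem octahedralW_ne_zero : octahedralW τ ≠ 0 :=
  div_ne_zero (theta2_ne_zero (two_mul_im_pos hτ)) (theta3_ne_zero (two_mul_im_pos hτ))

/-- By Jacobi's quartic identity, 1 - w⁴ is ϑ₄(2τ)⁴/ϑ₃(2τ)⁴. -/
theorem octahedralW_pow_four_ne_one : octahedralW τ ^ 4 ≠ 1 := by
  intro h
  have h3 := theta3_ne_zero (two_mul_im_pos hτ)
  rw [octahedralW, div_pow, div_eq_one_iff_eq (pow_ne_zero 4 h3),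
    theta3_pow_four (two_mul_im_pos hτ), left_eq_add] at h
  exact theta4_ne_zero (two_mul_im_pos hτ) (pow_eq_zero_iff four_ne_zero |>.1 h)

theorem one_add_octahedralW_ne_zero : 1 + octahedralW τ ≠ 0 := fun h =>
  octahedralW_pow_four_ne_one hτ (by rw [show octahedralW τ = -1 by linear_combination h]; norm_num)

theorem one_add_I_mul_octahedralW_ne_zero : 1 + Complex.I * octahedralW τ ≠ 0 := fun h =>
  octahedralW_pow_four_ne_one hτ (by
    rw [show octahedralW τ = Complex.I by
      linear_combination -Complex.I * h + octahedralW τ * Complex.I_sq, Complex.I_pow_four])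

theorem theta3_half : theta3 (τ / 2) = theta3 (2 * τ) * (1 + octahedralW τ) := by
  rw [theta3_add_theta2 (half_im_pos hτ), octahedralW, mul_add,
    mul_div_cancel₀ _ (theta3_ne_zero (two_mul_im_pos hτ)), show 4 * (τ / 2) = 2 * τ by ring, mul_one]

theorem theta4_half : theta4 (τ / 2) = theta3 (2 * τ) * (1 - octahedralW τ) := by
  rw [theta4_eq_sub (half_im_pos hτ), octahedralW, mul_sub,
    mul_div_cancel₀ _ (theta3_ne_zero (two_mul_im_pos hτ)), show 4 * (τ / 2) = 2 * τ by ring, mul_one]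

theorem burnsideX_eq : burnsideX τ = -((1 - octahedralW τ) / (1 + octahedralW τ)) := by
  rw [burnsideX, theta3_half hτ, theta4_half hτ, mul_div_mul_left]
  exact theta3_ne_zero (two_mul_im_pos hτ)

/-- Squaring leaves ϑ₄(τ)², which is ϑ₃ϑ₄ at τ/2; Jacobi's quartic identity at τ/2 does the rest. -/
theorem burnsideY_sq : burnsideY τ ^ 2 = burnsideX τ ^ 5 - burnsideX τ := by
  have h3 := theta3_ne_zero (half_im_pos hτ)
  have h := theta3_mul_theta4 (half_im_pos hτ)
  have h4 := theta3_pow_four (half_im_pos hτ)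
  rw [mul_div_cancel₀ _ (two_ne_zero' ℂ)] at h
  rw [burnsideY, burnsideX]
  field_simp
  rw [← h]
  linear_combination (-theta4 (τ / 2)) * theta3 (τ / 2) * h4

theorem burnsideY_sq_eq : burnsideY τ ^ 2 =
    8 * (octahedralW τ - octahedralW τ ^ 5) / (1 + octahedralW τ) ^ 6 := by
  have h := one_add_octahedralW_ne_zero hτ
  rw [burnsideY_sq hτ, burnsideX_eq hτ]
  field_simp
  ring

theorem burnsideY_ne_zero : burnsideY τ ≠ 0 := by
  have h2 := theta2_ne_zero (half_im_pos hτ)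
  have h3 := theta3_ne_zero (half_im_pos hτ)
  have h4 := theta4_ne_zero hτ
  rw [burnsideY]
  exact neg_ne_zero.2 (mul_ne_zero (div_ne_zero h4 h3) (div_ne_zero (pow_ne_zero 2 h2)
    (pow_ne_zero 2 h3)))

theorem differentiableAt_burnsideX : DifferentiableAt ℂ burnsideX τ := by
  have hd : DifferentiableAt ℂ (fun τ : ℂ => τ / 2) τ := by fun_prop
  have h3 : DifferentiableAt ℂ (fun τ => theta3 (τ / 2)) τ :=
    DifferentiableAt.comp (g := theta3) τ (differentiableAt_theta3 (half_im_pos hτ)) hd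
  have h4 : DifferentiableAt ℂ (fun τ => theta4 (τ / 2)) τ :=
    DifferentiableAt.comp (g := theta4) τ (differentiableAt_theta4 (half_im_pos hτ)) hd
  exact (h4.div h3 (theta3_ne_zero (half_im_pos hτ))).neg

theorem differentiableAt_burnsideY : DifferentiableAt ℂ burnsideY τ := by
  have hd : DifferentiableAt ℂ (fun τ : ℂ => τ / 2) τ := by fun_prop
  have h3 : DifferentiableAt ℂ (fun τ => theta3 (τ / 2)) τ :=
    DifferentiableAt.comp (g := theta3) τ (differentiableAt_theta3 (half_im_pos hτ)) hd
  have h2 : DifferentiableAt ℂ (fun τ => theta2 (τ / 2)) τ :=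
    DifferentiableAt.comp (g := theta2) τ (differentiableAt_theta2 (half_im_pos hτ)) hd
  have h0 := theta3_ne_zero (half_im_pos hτ)
  exact (((differentiableAt_theta4 hτ).div h3 h0).mul ((h2.pow 2).div (h3.pow 2)
    (pow_ne_zero 2 h0))).neg

theorem differentiableAt_octahedralW : DifferentiableAt ℂ octahedralW τ := by
  have hd : DifferentiableAt ℂ (fun τ : ℂ => 2 * τ) τ := by fun_prop
  exact ((differentiableAt_theta2 (two_mul_im_pos hτ)).comp τ hd).div
    ((differentiableAt_theta3 (two_mul_im_pos hτ)).comp τ hd) (theta3_ne_zero (two_mul_im_pos hτ))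

/-- The inversion turns ϑ₂ into ϑ₄ and preserves ϑ₃ up to a common automorphy factor, which cancels
in the quotient. -/
theorem octahedralW_neg_inv :
    octahedralW (-τ)⁻¹ = (1 - octahedralW τ) / (1 + octahedralW τ) := by
  have h0 : τ ≠ 0 := fun h => by simp [h] at hτ
  have e3 := jacobiTheta₂_functional_equation 0 (τ / 2)
  have e4 := jacobiTheta₂_functional_equation (1 / 2) (τ / 2)
  have h3 := theta3_ne_zero (half_im_pos hτ)
  have hx : (1 - octahedralW τ) / (1 + octahedralW τ) = theta4 (τ / 2) / theta3 (τ / 2) := by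
    rw [theta3_half hτ, theta4_half hτ, mul_div_mul_left]
    exact theta3_ne_zero (two_mul_im_pos hτ)
  have hc : (1 / (-Complex.I * (τ / 2)) ^ (1 / 2 : ℂ)) ≠ 0 := by
    intro h
    rw [h, zero_mul, zero_mul] at e3
    exact h3 e3
  rw [hx, octahedralW, theta4, theta3, theta3, theta2, e3, e4,
    show (-1 / (τ / 2) : ℂ) = 2 * (-τ)⁻¹ by field_simp,
    show (1 / 2 / (τ / 2) : ℂ) = -(2 * (-τ)⁻¹ / 2) by field_simp, jacobiTheta₂_neg_left,
    show -Real.pi * Complex.I * (1 / 2) ^ 2 / (τ / 2) =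
      Real.pi * Complex.I * (2 * (-τ)⁻¹) / 4 by field_simp; norm_num]
  simp only [zero_div, zero_pow two_ne_zero, mul_zero, Complex.exp_zero, mul_one]
  rw [mul_assoc (1 / _), mul_div_mul_left _ _ hc]

end Pointwise

theorem octahedralW_add_one (τ : ℂ) : octahedralW (τ + 1) = Complex.I * octahedralW τ := by
  rw [octahedralW, octahedralW, show 2 * (τ + 1) = 2 * τ + 2 by ring, theta2_add_two,
    theta3_add_two, mul_div_assoc]

/-- Only ϑ₂(τ/2) is affected: it acquires a factor i, which is squared. -/
theorem burnsideY_add_four (τ : ℂ) : burnsideY (τ + 4) = -burnsideY τ := by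
  rw [burnsideY, burnsideY, show (τ + 4) / 2 = τ / 2 + 2 by ring, theta3_add_two, theta2_add_two,
    show τ + 4 = τ + 2 + 2 by ring, theta4_add_two, theta4_add_two, mul_pow, Complex.I_sq]
  ring

/-! ### The action of the modular group -/

theorem octahedralW_T_smul (τ : ℍ) :
    octahedralW (ModularGroup.T • τ : ℍ) = Complex.I * octahedralW τ := by
  rw [modular_T_smul, coe_vadd, Complex.ofReal_one, add_comm, octahedralW_add_one]

theorem octahedralW_S_smul (τ : ℍ) : octahedralW (ModularGroup.S • τ : ℍ) =
    (1 - octahedralW τ) / (1 + octahedralW τ) := by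
  rw [modular_S_smul]
  exact octahedralW_neg_inv τ.im_pos

theorem octahedralW_T_zpow_smul (n : ℤ) (τ : ℍ) :
    octahedralW (ModularGroup.T ^ n • τ : ℍ) = Complex.I ^ n * octahedralW τ := by
  induction n with
  | zero => simp
  | succ n ih =>
    rw [add_comm, zpow_add, mul_smul, zpow_one, octahedralW_T_smul, ih,
      zpow_add₀ Complex.I_ne_zero, zpow_one, mul_assoc]
  | pred n ih =>
    have h := octahedralW_T_smul (ModularGroup.T ^ (-(n : ℤ) - 1) • τ)
    rw [← mul_smul, ← zpow_one_add, add_sub_cancel, ih] at h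
    refine mul_left_cancel₀ Complex.I_ne_zero (h.symm.trans ?_)
    rw [← mul_assoc, ← zpow_one_add₀ Complex.I_ne_zero, add_sub_cancel]

theorem burnsideX_eq_neg_octahedralW (τ : ℍ) :
    burnsideX τ = -octahedralW (ModularGroup.S • τ : ℍ) := by
  rw [octahedralW_S_smul, burnsideX_eq τ.im_pos]

theorem continuous_octahedralW : Continuous fun τ : ℍ => octahedralW τ :=
  continuous_iff_continuousAt.2 fun τ =>
    ((differentiableAt_octahedralW τ.im_pos).continuousAt.comp
      continuous_coe.continuousAt : _)

theorem continuous_burnsideY : Continuous fun τ : ℍ => burnsideY τ :=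
  continuous_iff_continuousAt.2 fun τ =>
    ((differentiableAt_burnsideY τ.im_pos).continuousAt.comp
      continuous_coe.continuousAt : _)

/-- Two continuous functions without zeros on the connected ℍ that have equal squares agree up to
one global sign. The value of the sign is never needed. -/
theorem burnsideY_smul_eq_or {γ : SL(2, ℤ)} {G : ℍ → ℂ} (hG : Continuous G) (h0 : ∀ τ, G τ ≠ 0)
    (h : ∀ τ : ℍ, burnsideY (γ • τ : ℍ) ^ 2 = (G τ * burnsideY τ) ^ 2) :
    ∃ s : ℂ, s ≠ 0 ∧ ∀ τ : ℍ, burnsideY (γ • τ : ℍ) = s * G τ * burnsideY τ := by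
  have hγ : Continuous fun τ : ℍ => burnsideY (γ • τ : ℍ) :=
    continuous_burnsideY.comp (continuous_const_smul (Matrix.SpecialLinearGroup.mapGL ℝ γ))
  have := (isPreconnected_univ (α := ℍ)).eq_or_eq_neg_of_sq_eq hγ.continuousOn
    (hG.mul continuous_burnsideY).continuousOn (fun τ _ => h τ)
    (fun {τ} _ => mul_ne_zero (h0 τ) (burnsideY_ne_zero τ.im_pos))
  rcases this with h | h
  · exact ⟨1, one_ne_zero, fun τ => by rw [one_mul]; exact h (Set.mem_univ τ)⟩
  · refine ⟨-1, by norm_num, fun τ => (h (Set.mem_univ τ)).trans ?_⟩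
    simp

/-- `γ` is compatible with `w` and `φ`: `w ∘ γ` and the quotient `φ ∘ γ / φ` are functions of
`w`. -/
def IsCompatible (γ : SL(2, ℤ)) : Prop :=
  ∀ τ τ' : ℍ, (octahedralW (γ • τ : ℍ) = octahedralW (γ • τ' : ℍ) ↔
    octahedralW τ = octahedralW τ') ∧
    (octahedralW τ = octahedralW τ' →
      burnsideY (γ • τ : ℍ) * burnsideY τ' = burnsideY (γ • τ' : ℍ) * burnsideY τ)

theorem isCompatible_T : IsCompatible ModularGroup.T := by
  -- Under w ↦ iw the function y² is multiplied by i((1 + w)/(1 + iw))⁶, whose square root needs √i.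
  obtain ⟨c, hc⟩ := IsAlgClosed.exists_pow_nat_eq Complex.I two_pos
  have hc0 : c ≠ 0 := fun h => Complex.I_ne_zero (by rw [← hc, h, zero_pow two_ne_zero])
  have h1 := fun τ : ℍ => one_add_octahedralW_ne_zero τ.im_pos
  have hI := fun τ : ℍ => one_add_I_mul_octahedralW_ne_zero τ.im_pos
  have hw := continuous_octahedralW
  obtain ⟨s, -, h⟩ := burnsideY_smul_eq_or (γ := ModularGroup.T)
    (G := fun τ : ℍ => c * ((1 + octahedralW τ) / (1 + Complex.I * octahedralW τ)) ^ 3)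
    (continuous_const.mul (((continuous_const.add hw).div
      (continuous_const.add (continuous_const.mul hw)) hI).pow 3))
    (fun τ => mul_ne_zero hc0 (pow_ne_zero 3 (div_ne_zero (h1 τ) (hI τ)))) (fun τ => by
      have hI4 := Complex.I_pow_four
      simp only [mul_pow, hc]
      rw [burnsideY_sq_eq (ModularGroup.T • τ).im_pos, burnsideY_sq_eq τ.im_pos,
        octahedralW_T_smul]
      have := h1 τ
      have := hI τ
      field_simp
      linear_combination -octahedralW τ ^ 5 * hI4)
  intro τ τ'
  refine ⟨?_, fun e => ?_⟩
  · rw [octahedralW_T_smul, octahedralW_T_smul, mul_right_inj' Complex.I_ne_zero]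
  · rw [h, h, e]
    ring

theorem isCompatible_S : IsCompatible ModularGroup.S := by
  -- Here y² ∘ S = w - w⁵, so the multiplier of y² is (1 + w)⁶/8.
  obtain ⟨c, hc⟩ := IsAlgClosed.exists_pow_nat_eq (8 : ℂ) two_pos
  have hc0 : c ≠ 0 := fun h => by simp [h] at hc
  have h1 := fun τ : ℍ => one_add_octahedralW_ne_zero τ.im_pos
  have hw := continuous_octahedralW
  obtain ⟨s, -, h⟩ := burnsideY_smul_eq_or (γ := ModularGroup.S)
    (G := fun τ : ℍ => (1 + octahedralW τ) ^ 3 / c)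
    (((continuous_const.add hw).pow 3).div_const c)
    (fun τ => div_ne_zero (pow_ne_zero 3 (h1 τ)) hc0) (fun τ => by
      simp only [mul_pow, div_pow, hc]
      rw [burnsideY_sq_eq (ModularGroup.S • τ).im_pos, burnsideY_sq_eq τ.im_pos,
        octahedralW_S_smul]
      have := h1 τ
      have h2 : 1 + (1 - octahedralW τ) / (1 + octahedralW τ) = 2 / (1 + octahedralW τ) := by
        field_simp
        ring
      rw [h2]
      field_simp
      ring)
  intro τ τ'
  refine ⟨?_, fun e => ?_⟩
  · rw [octahedralW_S_smul, octahedralW_S_smul, div_eq_div_iff (h1 τ) (h1 τ')]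
    constructor
    · intro e
      linear_combination -e / 2
    · intro e
      rw [e]
  · rw [h, h, e]
    ring

/-- Compatibility passes to products and inverses, so S and T suffice. The equivalence in its first
clause is what makes inverses work. -/
theorem isCompatible (γ : SL(2, ℤ)) : IsCompatible γ := by
  have hγ : γ ∈ Subgroup.closure {ModularGroup.S, ModularGroup.T} := by
    rw [SpecialLinearGroup.SL2Z_generators]
    exact Subgroup.mem_top γ
  induction hγ using Subgroup.closure_induction with
  | mem γ h =>
    rcases h with rfl | rfl
    · exact isCompatible_S
    · exact isCompatible_T
  | one => intro τ τ'; simp [mul_comm]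
  | mul γ δ _ _ hγ hδ =>
    intro τ τ'
    simp only [mul_smul]
    refine ⟨(hγ _ _).1.trans (hδ _ _).1, fun h => ?_⟩
    have h1 := (hγ _ _).2 ((hδ τ τ').1.2 h)
    have h2 := (hδ _ _).2 h
    refine mul_right_cancel₀ (b := burnsideY (δ • τ : ℍ) * burnsideY (δ • τ' : ℍ))
      (mul_ne_zero (burnsideY_ne_zero (δ • τ).im_pos) (burnsideY_ne_zero (δ • τ').im_pos)) ?_
    linear_combination burnsideY (δ • τ : ℍ) * burnsideY τ' * h1 +
      burnsideY (γ • δ • τ' : ℍ) * burnsideY (δ • τ : ℍ) * h2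
  | inv γ _ hγ =>
    intro τ τ'
    have h1 := hγ (γ⁻¹ • τ) (γ⁻¹ • τ')
    simp only [smul_inv_smul] at h1
    exact ⟨h1.1.symm, fun h => by linear_combination - h1.2 (h1.1.1 h)⟩

/-! ### Conjugates of `T ^ 4` fix w and negate φ -/

theorem T_zpow_four_smul_coe (τ : ℍ) : ((ModularGroup.T ^ (4 : ℤ) • τ : ℍ) : ℂ) = τ + 4 := by
  rw [ModularGroup.coe_T_zpow_smul_eq]
  norm_num

theorem octahedralW_conj_T_smul (γ : SL(2, ℤ)) (τ : ℍ) :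
    octahedralW ((γ * ModularGroup.T ^ (4 : ℤ) * γ⁻¹) • τ : ℍ) = octahedralW τ := by
  have := (isCompatible γ (ModularGroup.T ^ (4 : ℤ) • γ⁻¹ • τ) (γ⁻¹ • τ)).1.2 (by
    rw [octahedralW_T_zpow_smul]
    norm_num)
  rwa [smul_inv_smul, ← mul_smul, ← mul_smul] at this

/-- The points γ⁻¹τ and T⁴γ⁻¹τ have the same w and opposite y; compatibility of γ transports this
relation to their images. -/
theorem burnsideY_conj_T_smul (γ : SL(2, ℤ)) (τ : ℍ) :
    burnsideY ((γ * ModularGroup.T ^ (4 : ℤ) * γ⁻¹) • τ : ℍ) = -burnsideY τ := by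
  have := (isCompatible γ (ModularGroup.T ^ (4 : ℤ) • γ⁻¹ • τ) (γ⁻¹ • τ)).2 (by
    rw [octahedralW_T_zpow_smul]
    norm_num)
  rw [smul_inv_smul, ← mul_smul, ← mul_smul, T_zpow_four_smul_coe, burnsideY_add_four] at this
  refine mul_right_cancel₀ (burnsideY_ne_zero (γ⁻¹ • τ).im_pos) (this.trans ?_)
  ring

theorem burnsideX_eq_of_octahedralW_eq {τ τ' : ℍ} (h : octahedralW τ = octahedralW τ') :
    burnsideX τ = burnsideX τ' := by
  rw [burnsideX_eq τ.im_pos, burnsideX_eq τ'.im_pos, h]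

/-! ### Generators of `Γ(4)` -/

theorem sl_mul_apply (A B : SL(2, ℤ)) (i j : Fin 2) :
    (A * B) i j = A i 0 * B 0 j + A i 1 * B 1 j := by
  rw [Matrix.SpecialLinearGroup.coe_mul, Matrix.mul_apply, Fin.sum_univ_two]

theorem slToPSL_smul (γ : SL(2, ℤ)) (τ : ℍ) : slToPSL γ • τ = γ • τ := rfl

theorem slToPSL_neg (γ : SL(2, ℤ)) : slToPSL (-γ) = slToPSL γ := by
  have h : slToPSL (-1) = 1 := by
    refine (QuotientGroup.eq_one_iff _).2 (Subgroup.mem_center_iff.2 fun g => ?_)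
    ext i j
    simp
  rw [← neg_one_mul, map_mul, h, one_mul]

/-- The matrix of `T ^ k V₁ ^ ε T ^ (-k)` for `ε = ± 1`. -/
def matrixU (k ε : ℤ) : SL(2, ℤ) :=
  ⟨!![1 - 4 * ε * k, 4 * ε * k ^ 2; -4 * ε, 1 + 4 * ε * k], by
    rw [Matrix.det_fin_two_of]; ring⟩

theorem coe_T_zpow_four_mul (q : ℤ) :
    ((ModularGroup.T ^ (4 * q) : SL(2, ℤ)) : Matrix (Fin 2) (Fin 2) ℤ) = !![1, 4 * q; 0, 1] := by
  rw [ModularGroup.coe_T_zpow]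

theorem matrixV_zero : matrixV 0 = ModularGroup.T ^ (4 : ℤ) := by
  ext i j
  rw [ModularGroup.coe_T_zpow]
  rfl

theorem T_zpow_four_mul_mem (q : ℤ) :
    slToPSL (ModularGroup.T ^ (4 * q)) ∈ Subgroup.closure (Set.range genV) := by
  rw [zpow_mul, map_zpow, ← matrixV_zero]
  exact zpow_mem (Subgroup.subset_closure (Set.mem_range_self (f := genV) 0)) q

/-- Modulo conjugation by powers of V₀ only k mod 4 matters, which leaves V₁, …, V₄. -/
theorem matrixU_add (k q ε : ℤ) : matrixU (k + 4 * q) ε =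
    ModularGroup.T ^ (4 * q) * matrixU k ε * (ModularGroup.T ^ (4 * q))⁻¹ := by
  rw [eq_mul_inv_iff_mul_eq]
  ext i j
  rw [sl_mul_apply, sl_mul_apply, coe_T_zpow_four_mul]
  fin_cases i <;> fin_cases j <;> simp [matrixU] <;> ring

theorem matrixU_neg (k : ℤ) : matrixU k (-1) = (matrixU k 1)⁻¹ := by
  rw [eq_inv_iff_mul_eq_one]
  ext i j
  rw [sl_mul_apply]
  fin_cases i <;> fin_cases j <;> simp [matrixU] <;> ring

theorem genV_one : genV 1 = slToPSL (matrixU 0 1) := by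
  rw [genV]; congr 1

theorem genV_two : genV 2 = slToPSL (matrixU 1 1) := by
  rw [genV, ← slToPSL_neg]; congr 1; decide

theorem genV_three : genV 3 = slToPSL (matrixU 2 1) := by
  rw [genV, ← slToPSL_neg]; congr 1; decide

theorem genV_four : genV 4 = slToPSL (matrixU 3 1) := by
  rw [genV, ← slToPSL_neg]; congr 1; decide

theorem matrixU_one_mem (k : ℤ) :
    slToPSL (matrixU k 1) ∈ Subgroup.closure (Set.range genV) := by
  have h : slToPSL (matrixU (k % 4) 1) ∈ Subgroup.closure (Set.range genV) := by
    have h1 := Int.emod_nonneg k four_ne_zero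
    have h2 := Int.emod_lt_of_pos k four_pos
    generalize k % 4 = r at *
    interval_cases r
    · exact Subgroup.subset_closure ⟨1, genV_one⟩
    · exact Subgroup.subset_closure ⟨2, genV_two⟩
    · exact Subgroup.subset_closure ⟨3, genV_three⟩
    · exact Subgroup.subset_closure ⟨4, genV_four⟩
  rw [← Int.emod_add_mul_ediv k 4, matrixU_add, map_mul, map_mul, map_inv]
  exact mul_mem (mul_mem (T_zpow_four_mul_mem _) h) (inv_mem (T_zpow_four_mul_mem _))

theorem matrixU_mem (k : ℤ) {ε : ℤ} (hε : ε = 1 ∨ ε = -1) :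
    slToPSL (matrixU k ε) ∈ Subgroup.closure (Set.range genV) := by
  rcases hε with rfl | rfl
  · exact matrixU_one_mem k
  · rw [matrixU_neg, map_inv]
    exact inv_mem (matrixU_one_mem k)

theorem exists_abs_add_mul_le (d : ℤ) {c : ℤ} (hc : c ≠ 0) : ∃ k : ℤ, 2 * |d + k * c| ≤ |c| := by
  refine ⟨-round ((d : ℚ) / c), ?_⟩
  have h := abs_sub_round ((d : ℚ) / c)
  have hc' : (c : ℚ) ≠ 0 := by exact_mod_cast hc
  have e : ((d + -round ((d : ℚ) / c) * c : ℤ) : ℚ) = ((d : ℚ) / c - round ((d : ℚ) / c)) * c := by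
    push_cast
    field_simp
    ring
  have : (2 * |d + -round ((d : ℚ) / c) * c| : ℤ) ≤ ((|c| : ℤ) : ℚ) := by
    rw [Int.cast_mul, Int.cast_abs, Int.cast_abs, e, abs_mul]
    have := abs_nonneg (c : ℚ)
    push_cast
    nlinarith
  exact_mod_cast this

/-- Euclidean descent on |c|: right multiplication by `matrixU k ε` replaces c by c - 4ε(d + kc).
Divisibility of the off-diagonal entries describes ±Γ(4), so the sign of γ need not be tracked. -/
theorem mem_closure_genV_of_dvd (γ : SL(2, ℤ)) (hb : 4 ∣ γ 0 1) (hc : 4 ∣ γ 1 0) :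
    slToPSL γ ∈ Subgroup.closure (Set.range genV) := by
  induction hn : (γ 1 0).natAbs using Nat.strong_induction_on generalizing γ with
  | _ n ih =>
  have hdet := γ.det_coe
  rw [Matrix.det_fin_two] at hdet
  rcases eq_or_ne (γ 1 0) 0 with h0 | h0
  · rw [h0, mul_zero, sub_zero] at hdet
    obtain ⟨q, hq⟩ := hb
    rcases Int.mul_eq_one_iff_eq_one_or_neg_one.1 hdet with ⟨ha, hd⟩ | ⟨ha, hd⟩
    · have : γ = ModularGroup.T ^ (4 * q) := by
        ext i j
        rw [coe_T_zpow_four_mul]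
        fin_cases i <;> fin_cases j <;> simp [*]
      rw [this]
      exact T_zpow_four_mul_mem q
    · have : -γ = ModularGroup.T ^ (4 * -q) := by
        ext i j
        rw [coe_T_zpow_four_mul]
        fin_cases i <;> fin_cases j <;> simp [*]
      rw [← slToPSL_neg, this]
      exact T_zpow_four_mul_mem (-q)
  · obtain ⟨k, hk⟩ := exists_abs_add_mul_le (γ 1 1) h0
    obtain ⟨c', hc'⟩ := hc
    obtain ⟨b', hb'⟩ := hb
    set a := γ 0 0
    set b := γ 0 1
    set c := γ 1 0
    set d := γ 1 1
    have hodd : Odd (d + k * c) := by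
      have h1 : Odd (a * d) := ⟨2 * b' * c, by linear_combination hdet + hb' * c⟩
      exact (Int.odd_mul.1 h1).2.add_even (by rw [hc']; exact ⟨k * 2 * c', by ring⟩)
    -- Equality would make the odd number d + kc equal in absolute value to the even number |c|/2.
    have hlt : 2 * |d + k * c| < |c| := by
      refine lt_of_le_of_ne hk fun h => ?_
      rw [hc', abs_mul] at h
      have h2 : |d + k * (4 * c')| = 2 * |c'| := by
        simp at h
        omega
      rw [hc'] at hodd
      have h3 : Odd |d + k * (4 * c')| := odd_abs.2 hodd
      rw [h2] at h3
      exact Int.not_odd_iff_even.2 (even_two_mul _) h3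
    have hne : d + k * c ≠ 0 := fun h => by simp [h] at hodd
    -- As 0 < 4|d + kc| < 2|c|, taking ε to be the sign of c(d + kc) strictly decreases |c|.
    obtain ⟨ε, hε, hlt'⟩ : ∃ ε : ℤ, (ε = 1 ∨ ε = -1) ∧ |c - 4 * ε * (d + k * c)| < |c| := by
      generalize d + k * c = r at *
      rcases lt_or_gt_of_ne h0 with h | h <;> rcases lt_or_gt_of_ne hne with h' | h'
      · refine ⟨1, Or.inl rfl, ?_⟩
        rw [abs_of_neg h, abs_of_neg h'] at hlt
        rw [abs_of_neg h, abs_lt]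
        constructor <;> linarith
      · refine ⟨-1, Or.inr rfl, ?_⟩
        rw [abs_of_neg h, abs_of_pos h'] at hlt
        rw [abs_of_neg h, abs_lt]
        constructor <;> linarith
      · refine ⟨-1, Or.inr rfl, ?_⟩
        rw [abs_of_pos h, abs_of_neg h'] at hlt
        rw [abs_of_pos h, abs_lt]
        constructor <;> linarith
      · refine ⟨1, Or.inl rfl, ?_⟩
        rw [abs_of_pos h, abs_of_pos h'] at hlt
        rw [abs_of_pos h, abs_lt]
        constructor <;> linarith
    have e1 : (γ * matrixU k ε) 1 0 = c - 4 * ε * (d + k * c) := by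
      rw [sl_mul_apply]
      simp [matrixU, c, d]
      ring
    have e2 : (γ * matrixU k ε) 0 1 = 4 * (a * ε * k ^ 2 + b' * (1 + 4 * ε * k)) := by
      have : (γ * matrixU k ε) 0 1 = a * (4 * ε * k ^ 2) + b * (1 + 4 * ε * k) := by
        rw [sl_mul_apply]
        simp [matrixU, a, b]
      rw [this, hb']
      ring
    have := ih _ (by rw [← hn, e1]; exact Int.ofNat_lt.1 (by simpa using hlt')) (γ * matrixU k ε) ⟨_, e2⟩
      (by rw [e1, hc']; exact ⟨c' - ε * (d + k * (4 * c')), by ring⟩) rfl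
    rw [map_mul] at this
    exact (mul_mem_cancel_right (matrixU_mem k hε)).1 this

theorem slToPSL_mem_gammaFour_of_mem_gamma {γ : SL(2, ℤ)} (h : γ ∈ CongruenceSubgroup.Gamma 4) :
    slToPSL γ ∈ gammaFour := Subgroup.mem_map_of_mem _ h

theorem matrixU_mem_gamma (k : ℤ) : matrixU k 1 ∈ CongruenceSubgroup.Gamma 4 := by
  have h4 : (4 : ZMod 4) = 0 := rfl
  rw [CongruenceSubgroup.Gamma_mem]
  simp [matrixU, h4]

theorem genV_mem (i : Fin 5) : genV i ∈ gammaFour := by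
  fin_cases i
  · refine slToPSL_mem_gammaFour_of_mem_gamma ?_
    rw [CongruenceSubgroup.Gamma_mem]
    decide
  · exact genV_one ▸ slToPSL_mem_gammaFour_of_mem_gamma (matrixU_mem_gamma 0)
  · exact genV_two ▸ slToPSL_mem_gammaFour_of_mem_gamma (matrixU_mem_gamma 1)
  · exact genV_three ▸ slToPSL_mem_gammaFour_of_mem_gamma (matrixU_mem_gamma 2)
  · exact genV_four ▸ slToPSL_mem_gammaFour_of_mem_gamma (matrixU_mem_gamma 3)

theorem closure_range_genV : Subgroup.closure (Set.range genV) = gammaFour := by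
  refine le_antisymm ((Subgroup.closure_le _).2 (Set.range_subset_iff.2 genV_mem)) ?_
  rintro _ ⟨γ, hγ, rfl⟩
  obtain ⟨-, hb, hc, -⟩ := CongruenceSubgroup.Gamma_mem.1 hγ
  exact mem_closure_genV_of_dvd γ (by exact_mod_cast (ZMod.intCast_zmod_eq_zero_iff_dvd _ 4).1 hb)
    (by exact_mod_cast (ZMod.intCast_zmod_eq_zero_iff_dvd _ 4).1 hc)

theorem slToPSL_mem_gammaFour {γ : SL(2, ℤ)} (hb : 4 ∣ γ 0 1) (hc : 4 ∣ γ 1 0) :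
    slToPSL γ ∈ gammaFour := closure_range_genV ▸ mem_closure_genV_of_dvd γ hb hc

/-! ### The sign character -/

/-- Each V is a generator of a cusp stabilizer: V₁, …, V₄ come from T⁴ by moving ∞ to the cusps 0,
1, 2, 3. -/
theorem genV_eq_conj (i : Fin 5) :
    ∃ γ : SL(2, ℤ), genV i = slToPSL (γ * ModularGroup.T ^ (4 : ℤ) * γ⁻¹) := by
  have key : ∀ k : ℤ, matrixU k 1 = (ModularGroup.T ^ k * ModularGroup.S) *
      ModularGroup.T ^ (4 : ℤ) * (ModularGroup.T ^ k * ModularGroup.S)⁻¹ := by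
    intro k
    rw [eq_mul_inv_iff_mul_eq]
    ext i j
    rw [sl_mul_apply, sl_mul_apply]
    simp only [sl_mul_apply, ModularGroup.coe_T_zpow, ModularGroup.coe_S]
    fin_cases i <;> fin_cases j <;> simp [matrixU] <;> ring
  fin_cases i
  · exact ⟨1, by rw [one_mul, inv_one, mul_one, ← matrixV_zero]; rfl⟩
  · exact ⟨_, genV_one.trans (congrArg _ (key 0))⟩
  · exact ⟨_, genV_two.trans (congrArg _ (key 1))⟩
  · exact ⟨_, genV_three.trans (congrArg _ (key 2))⟩
  · exact ⟨_, genV_four.trans (congrArg _ (key 3))⟩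

theorem octahedralW_genV_smul (i : Fin 5) (τ : ℍ) :
    octahedralW (genV i • τ : ℍ) = octahedralW τ := by
  obtain ⟨γ, h⟩ := genV_eq_conj i
  rw [h]
  exact octahedralW_conj_T_smul γ τ

theorem burnsideY_genV_smul (i : Fin 5) (τ : ℍ) :
    burnsideY (genV i • τ : ℍ) = -burnsideY τ := by
  obtain ⟨γ, h⟩ := genV_eq_conj i
  rw [h]
  exact burnsideY_conj_T_smul γ τ

theorem gammaFour_le_automorphismGroup_octahedralW :
    gammaFour ≤ automorphismGroup (fun τ : ℍ => octahedralW τ) := by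
  rw [← closure_range_genV, Subgroup.closure_le]
  rintro _ ⟨i, rfl⟩
  exact octahedralW_genV_smul i

theorem gammaFour_le_automorphismGroup_burnsideX :
    gammaFour ≤ automorphismGroup (fun τ : ℍ => burnsideX τ) := fun _ hg τ =>
  burnsideX_eq_of_octahedralW_eq (gammaFour_le_automorphismGroup_octahedralW hg τ)

/-! ### The subgroup of words of even length in the generators of Γ(4) -/

theorem genT_eq :
    genT 0 = genV 0 * genV 0 ∧
      genT 1 = genV 0 * genV 1 ∧ genT 5 = genV 0 * (genV 1)⁻¹ ∧
      genT 2 = genV 0 * genV 2 ∧ genT 6 = genV 0 * (genV 2)⁻¹ ∧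
      genT 3 = genV 0 * genV 3 ∧ genT 7 = genV 0 * (genV 3)⁻¹ ∧
      genT 4 = genV 0 * genV 4 ∧ genT 8 = genV 0 * (genV 4)⁻¹ := by
  simp only [genT, genV, ← map_mul, ← map_inv]
  refine ⟨?_, ?_, ?_, ?_, ?_, ?_, ?_, ?_, ?_⟩
  all_goals first
    | (congr 1; decide)
    | (rw [← slToPSL_neg]; congr 1; decide)

theorem closure_range_genT_le :
    Subgroup.closure (Set.range genT) ≤ automorphismGroup (fun τ : ℍ => burnsideY τ) := by
  have hV : ∀ (i : Fin 5) (τ : ℍ), burnsideY ((genV i)⁻¹ • τ : ℍ) = -burnsideY τ := by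
    intro i τ
    have := burnsideY_genV_smul i ((genV i)⁻¹ • τ)
    rw [smul_inv_smul] at this
    rw [this, neg_neg]
  have key : ∀ (i j : Fin 5), genV i * genV j ∈ automorphismGroup (fun τ : ℍ => burnsideY τ) := by
    intro i j τ
    simp only
    rw [mul_smul, burnsideY_genV_smul, burnsideY_genV_smul, neg_neg]
  have key' : ∀ (i j : Fin 5),
      genV i * (genV j)⁻¹ ∈ automorphismGroup (fun τ : ℍ => burnsideY τ) := by
    intro i j τ
    simp only
    rw [mul_smul, burnsideY_genV_smul, hV, neg_neg]
  obtain ⟨h0, h1, h5, h2, h6, h3, h7, h4, h8⟩ := genT_eq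
  rw [Subgroup.closure_le]
  rintro _ ⟨i, rfl⟩
  fin_cases i
  · exact h0 ▸ key 0 0
  · exact h1 ▸ key 0 1
  · exact h2 ▸ key 0 2
  · exact h3 ▸ key 0 3
  · exact h4 ▸ key 0 4
  · exact h5 ▸ key' 0 1
  · exact h6 ▸ key' 0 2
  · exact h7 ▸ key' 0 3
  · exact h8 ▸ key' 0 4

theorem genV_zero_mul_mem (i : Fin 5) :
    genV 0 * genV i ∈ Subgroup.closure (Set.range genT) ∧
      genV 0 * (genV i)⁻¹ ∈ Subgroup.closure (Set.range genT) := by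
  obtain ⟨h0, h1, h5, h2, h6, h3, h7, h4, h8⟩ := genT_eq
  have h : ∀ j, genT j ∈ Subgroup.closure (Set.range genT) := fun j =>
    Subgroup.subset_closure ⟨j, rfl⟩
  fin_cases i
  · exact ⟨h0 ▸ h 0, by simp⟩
  · exact ⟨h1 ▸ h 1, h5 ▸ h 5⟩
  · exact ⟨h2 ▸ h 2, h6 ▸ h 6⟩
  · exact ⟨h3 ▸ h 3, h7 ▸ h 7⟩
  · exact ⟨h4 ▸ h 4, h8 ▸ h 8⟩

/-- Schreier's argument with transversal 1, V₀⁻¹: prepending a letter `genV i` or its inverse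
switches between the two alternatives. -/
theorem mem_or_genV_zero_mul_mem {g : PSL(2, ℝ)} (hg : g ∈ gammaFour) :
    g ∈ Subgroup.closure (Set.range genT) ∨ genV 0 * g ∈ Subgroup.closure (Set.range genT) := by
  rw [← closure_range_genV] at hg
  induction hg using Subgroup.closure_induction_left with
  | one => exact Or.inl (one_mem _)
  | mul_left x hx y hy ih =>
    obtain ⟨i, rfl⟩ := hx
    rcases ih with h | h
    · exact Or.inr (by rw [← mul_assoc]; exact mul_mem (genV_zero_mul_mem i).1 h)
    · refine Or.inl ?_
      have := mul_mem (inv_mem (genV_zero_mul_mem i).2) h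
      rwa [mul_inv_rev, inv_inv, mul_assoc, inv_mul_cancel_left] at this
  | inv_mul_cancel x hx y hy ih =>
    obtain ⟨i, rfl⟩ := hx
    rcases ih with h | h
    · exact Or.inr (by rw [← mul_assoc]; exact mul_mem (genV_zero_mul_mem i).2 h)
    · refine Or.inl ?_
      have := mul_mem (inv_mem (genV_zero_mul_mem i).1) h
      rwa [mul_inv_rev, mul_assoc, inv_mul_cancel_left] at this

theorem genV_zero_notMem : genV 0 ∉ automorphismGroup (fun τ : ℍ => burnsideY τ) := by
  intro h
  have h1 : burnsideY (genV 0 • UpperHalfPlane.I : ℍ) = burnsideY UpperHalfPlane.I :=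
    h UpperHalfPlane.I
  rw [burnsideY_genV_smul] at h1
  exact burnsideY_ne_zero UpperHalfPlane.I.im_pos (by linear_combination -h1 / 2)

theorem automorphismGroup_burnsideY_inf_gammaFour :
    automorphismGroup (fun τ : ℍ => burnsideY τ) ⊓ gammaFour =
      Subgroup.closure (Set.range genT) := by
  refine le_antisymm ?_ (le_inf closure_range_genT_le ?_)
  · rintro g ⟨hY, h4⟩
    refine (mem_or_genV_zero_mul_mem h4).resolve_right fun h => genV_zero_notMem ?_
    exact (Subgroup.mul_mem_cancel_right _ hY).1 (closure_range_genT_le h)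
  · have hV := genV_mem
    obtain ⟨h0, h1, h5, h2, h6, h3, h7, h4, h8⟩ := genT_eq
    rw [Subgroup.closure_le]
    rintro _ ⟨i, rfl⟩
    change genT i ∈ gammaFour
    fin_cases i
    · exact h0 ▸ mul_mem (hV 0) (hV 0)
    · exact h1 ▸ mul_mem (hV 0) (hV 1)
    · exact h2 ▸ mul_mem (hV 0) (hV 2)
    · exact h3 ▸ mul_mem (hV 0) (hV 3)
    · exact h4 ▸ mul_mem (hV 0) (hV 4)
    · exact h5 ▸ mul_mem (hV 0) (inv_mem (hV 1))
    · exact h6 ▸ mul_mem (hV 0) (inv_mem (hV 2))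
    · exact h7 ▸ mul_mem (hV 0) (inv_mem (hV 3))
    · exact h8 ▸ mul_mem (hV 0) (inv_mem (hV 4))

theorem relIndex_closure_range_genT :
    (Subgroup.closure (Set.range genT)).relIndex gammaFour = 2 := by
  rw [Subgroup.relIndex, Subgroup.index_eq_two_iff']
  refine ⟨⟨genV 0, genV_mem 0⟩, fun ⟨g, hg⟩ => ?_⟩
  simp only [Subgroup.mem_subgroupOf, Subgroup.coe_mul]
  rcases mem_or_genV_zero_mul_mem hg with h | h
  · refine Or.inr ⟨h, fun h' => genV_zero_notMem ?_⟩
    exact closure_range_genT_le ((mul_mem_cancel_right h).1 h')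
  · refine Or.inl ⟨h, fun h' => genV_zero_notMem ?_⟩
    exact closure_range_genT_le ((mul_mem_cancel_right h').1 h)

/-! ### A ping-pong lemma with a fundamental region -/

/-- A nonempty reduced word carries D into the set Z of its first letter, and that set misses D.
Reducedness ensures that the next letter's set is never the one on which the current letter is
uncontrolled. -/
theorem FreeGroup.disjoint_lift_smul {ι G α : Type*} [DecidableEq ι] [Group G] [MulAction G α]
    (a : ι → G) (Z : ι × Bool → Set α) (D : Set α)
    (hZ : ∀ p q, p ≠ q → Disjoint (Z p) (Z q)) (hD : ∀ p, Disjoint D (Z p))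
    (h : ∀ i, ∀ x ∉ Z (i, false), a i • x ∈ Z (i, true))
    (h' : ∀ i, ∀ x ∉ Z (i, true), (a i)⁻¹ • x ∈ Z (i, false))
    {w : FreeGroup ι} (hw : w ≠ 1) : Disjoint D (FreeGroup.lift a w • D) := by
  have hp : ∀ (p : ι × Bool), ∀ x ∉ Z (p.1, !p.2), cond p.2 (a p.1) (a p.1)⁻¹ • x ∈ Z p := by
    rintro ⟨i, b⟩ x hx
    cases b
    · exact h' i x hx
    · exact h i x hx
  have key : ∀ (L : List (ι × Bool)) (p : ι × Bool), FreeGroup.IsReduced (p :: L) →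
      ∀ x ∈ D, FreeGroup.lift a (FreeGroup.mk (p :: L)) • x ∈ Z p := by
    intro L
    induction L with
    | nil =>
      intro p _ x hx
      simp only [FreeGroup.lift_mk, List.map_cons, List.map_nil, List.prod_cons, List.prod_nil,
        mul_one]
      exact hp p x (Set.disjoint_left.1 (hD _) hx)
    | cons q L ih =>
      intro p hred x hx
      have h1 := FreeGroup.isReduced_cons_cons.1 hred
      have h2 := ih q h1.2 x hx
      rw [FreeGroup.lift_mk] at h2 ⊢
      rw [List.map_cons, List.prod_cons, mul_smul]
      refine hp p _ (Set.disjoint_left.1 (hZ q _ fun e => ?_) h2)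
      subst e
      have := h1.1 rfl
      simp at this
  have hne : w.toWord ≠ [] := fun h => hw (FreeGroup.toWord_eq_nil_iff.1 h)
  obtain ⟨p, L, hL⟩ := List.exists_cons_of_ne_nil hne
  have hred := FreeGroup.isReduced_toWord (x := w)
  rw [hL] at hred
  rw [← FreeGroup.mk_toWord (x := w), hL]
  refine Set.disjoint_right.2 ?_
  rintro _ ⟨x, hx, rfl⟩ hx'
  exact Set.disjoint_left.1 (hD p) hx' (key L p hred x hx)

theorem FreeGroup.lift_injective_of_disjoint {ι G α : Type*} [Group G] [MulAction G α]
    (a : ι → G) {D : Set α} (hD : D.Nonempty)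
    (h : ∀ w : FreeGroup ι, w ≠ 1 → Disjoint D (FreeGroup.lift a w • D)) :
    Function.Injective (FreeGroup.lift a) := by
  refine (injective_iff_map_eq_one _).2 fun w hw => by_contra fun hne => ?_
  have := h w hne
  rw [hw, one_smul, disjoint_self] at this
  exact hD.ne_empty this

/-! ### Isometric circles over the segments `[(i - 1) / 2, i / 2]` -/

/-- The normalized distance to the centre of the segment `[(i - 1) / 2, i / 2]`: the geodesic over
this segment is `arcDist i τ = 1`. -/
noncomputable def arcDist (i : ℕ) (τ : ℍ) : ℝ := ‖4 * (τ : ℂ) - (2 * i - 1)‖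

theorem arcDist_sq (i : ℕ) (τ : ℍ) :
    arcDist i τ ^ 2 = (4 * τ.re - (2 * i - 1)) ^ 2 + (4 * τ.im) ^ 2 := by
  rw [arcDist, Complex.sq_norm, Complex.normSq_apply]
  simp
  ring

theorem arcDist_nonneg (i : ℕ) (τ : ℍ) : 0 ≤ arcDist i τ := norm_nonneg _

theorem continuous_arcDist (i : ℕ) : Continuous (arcDist i) :=
  ((continuous_const.mul continuous_coe).sub continuous_const).norm

theorem abs_lt_arcDist (i : ℕ) (τ : ℍ) : |4 * τ.re - (2 * i - 1)| < arcDist i τ := by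
  have h := arcDist_sq i τ
  have := τ.im_pos
  refine abs_lt_of_sq_lt_sq ?_ (arcDist_nonneg i τ)
  rw [h]
  nlinarith

/-- The closed discs over neighbouring segments touch only on the real axis, so inside ℍ they are
disjoint. -/
theorem eq_of_arcDist_le_one {i j : ℕ} {τ : ℍ} (hi : arcDist i τ ≤ 1) (hj : arcDist j τ ≤ 1) :
    i = j := by
  have h1 := abs_lt.1 ((abs_lt_arcDist i τ).trans_le hi)
  have h2 := abs_lt.1 ((abs_lt_arcDist j τ).trans_le hj)
  have h3 : (i : ℝ) < j + 1 := by linarith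
  have h4 : (j : ℝ) < i + 1 := by linarith
  have h5 : i < j + 1 := by exact_mod_cast h3
  have h6 : j < i + 1 := by exact_mod_cast h4
  omega

theorem norm_sub_eq_arcDist (i : ℕ) (τ : ℍ) :
    ‖(τ : ℂ) - ((halfPoint i + halfPoint (i + 1)) / 2 : ℝ)‖ = arcDist i τ / 4 := by
  rw [arcDist, halfPoint, halfPoint, eq_div_iff four_ne_zero, mul_comm,
    show (4 : ℝ) = ‖(4 : ℂ)‖ by simp, ← norm_mul]
  congr 1
  push_cast
  ring

theorem mem_arcSide_iff (i : ℕ) (τ : ℍ) : τ ∈ arcSide i ↔ arcDist i τ = 1 := by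
  rw [arcSide, geodesicArc, Set.mem_ofPred_eq, norm_sub_eq_arcDist, halfPoint, halfPoint]
  push_cast
  constructor <;> intro h <;> linarith

/-- `g` maps the isometric circle over the segment `j` to the one over the segment `i`. -/
def MapsArc (g : PSL(2, ℝ)) (i j : ℕ) : Prop := ∀ τ : ℍ, arcDist i (g • τ) * arcDist j τ = 1

/-- For c = 4 and determinant 1, 4γτ - a = -1/(4τ + d); the entries a and d encode the centres of
the two isometric circles. -/
theorem mapsArc_slToPSL {γ : SL(2, ℤ)} {i j : ℕ} (hc : γ 1 0 = 4) (ha : γ 0 0 = 2 * i - 1)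
    (hd : γ 1 1 = -(2 * j - 1)) : MapsArc (slToPSL γ) i j := by
  intro τ
  have hdet := γ.det_coe
  rw [Matrix.det_fin_two, hc] at hdet
  have hdet' : (γ 0 0 : ℂ) * γ 1 1 - γ 0 1 * 4 = 1 := by exact_mod_cast hdet
  have hne : (4 : ℂ) * τ + γ 1 1 ≠ 0 := by
    intro h
    have := congrArg Complex.im h
    simp at this
    exact τ.im_ne_zero this
  have e1 : (2 * i - 1 : ℂ) = γ 0 0 := by rw [ha]; push_cast; ring
  have e2 : -(2 * j - 1 : ℂ) = γ 1 1 := by rw [hd]; push_cast; ring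
  rw [slToPSL_smul, arcDist, arcDist, ← norm_mul, sub_eq_add_neg _ (2 * (j : ℂ) - 1), e1, e2,
    coe_specialLinearGroup_apply, hc]
  simp only [algebraMap_int_eq, eq_intCast, Complex.ofReal_intCast, Complex.ofReal_ofNat, Int.cast_ofNat]
  rw [show (4 * (((γ 0 0 : ℂ) * τ + γ 0 1) / (4 * τ + γ 1 1)) - γ 0 0) * (4 * τ + γ 1 1) =
    -((γ 0 0 : ℂ) * γ 1 1 - γ 0 1 * 4) by field_simp; ring, hdet', norm_neg, norm_one]

theorem MapsArc.smul_arcSide {g : PSL(2, ℝ)} {i j : ℕ} (h : MapsArc g i j) :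
    g • arcSide j = arcSide i := by
  ext τ
  have := h (g⁻¹ • τ)
  rw [smul_inv_smul] at this
  rw [Set.mem_smul_set_iff_inv_smul_mem, mem_arcSide_iff, mem_arcSide_iff]
  constructor
  · intro e
    rwa [e, mul_one] at this
  · intro e
    rwa [e, one_mul] at this

theorem MapsArc.smul_le {g : PSL(2, ℝ)} {i j : ℕ} (h : MapsArc g i j) {τ : ℍ}
    (hτ : 1 ≤ arcDist j τ) : arcDist i (g • τ) ≤ 1 := by
  have h1 := h τ
  have := arcDist_nonneg i (g • τ)
  nlinarith

theorem MapsArc.inv_smul_lt {g : PSL(2, ℝ)} {i j : ℕ} (h : MapsArc g i j) {τ : ℍ}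
    (hτ : 1 < arcDist i τ) : arcDist j (g⁻¹ • τ) < 1 := by
  have h1 := h (g⁻¹ • τ)
  rw [smul_inv_smul] at h1
  have := arcDist_nonneg j (g⁻¹ • τ)
  by_contra! h2
  nlinarith

/-! ### The ideal polygons with vertices `∞, -1/2, 0, 1/2, …, (M - 1)/2` -/

/-- The ideal polygon with vertices `∞, -1/2, 0, 1/2, …, (M - 1)/2`. -/
noncomputable def halfPolygon (M : ℕ) : Set ℍ := idealPolygon (n := M) fun i => halfPoint i

theorem mem_halfPolygon_iff (M : ℕ) (τ : ℍ) : τ ∈ halfPolygon M ↔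
    -1 / 2 ≤ τ.re ∧ τ.re ≤ ((M : ℝ) - 1) / 2 ∧ ∀ i < M, 1 ≤ arcDist i τ := by
  rw [halfPolygon, idealPolygon, Set.mem_ofPred_eq, Fin.forall_iff]
  have e0 : halfPoint ((0 : Fin (M + 1)) : ℕ) = -1 / 2 := by simp [halfPoint]
  have e1 : halfPoint (Fin.last M : ℕ) = ((M : ℝ) - 1) / 2 := by simp [halfPoint]
  rw [e0, e1]
  refine and_congr Iff.rfl (and_congr Iff.rfl (forall₂_congr fun i hi => ?_))
  simp only [Fin.val_castSucc, Fin.val_succ, norm_sub_eq_arcDist]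
  rw [halfPoint, halfPoint]
  push_cast
  constructor <;> intro h <;> linarith

/-- The interior of `halfPolygon M`. -/
def openHalfPolygon (M : ℕ) : Set ℍ :=
  {τ | -1 / 2 < τ.re ∧ τ.re < ((M : ℝ) - 1) / 2 ∧ ∀ i < M, 1 < arcDist i τ}

theorem isOpen_openHalfPolygon (M : ℕ) : IsOpen (openHalfPolygon M) := by
  have h : openHalfPolygon M = {τ | -1 / 2 < τ.re} ∩ ({τ | τ.re < ((M : ℝ) - 1) / 2} ∩
      ⋂ i ∈ Finset.range M, {τ | 1 < arcDist i τ}) := by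
    ext τ
    simp [openHalfPolygon]
  rw [h]
  exact (isOpen_lt continuous_const continuous_re).inter
    ((isOpen_lt continuous_re continuous_const).inter
      (isOpen_biInter_finset fun i _ => isOpen_lt continuous_const (continuous_arcDist i)))

theorem isClosed_halfPolygon (M : ℕ) : IsClosed (halfPolygon M) := by
  have h : halfPolygon M = {τ | -1 / 2 ≤ τ.re} ∩ ({τ | τ.re ≤ ((M : ℝ) - 1) / 2} ∩
      ⋂ i, ⋂ (_ : i < M), {τ | 1 ≤ arcDist i τ}) := by
    ext τ
    simp [mem_halfPolygon_iff]
  rw [h]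
  exact (isClosed_le continuous_const continuous_re).inter
    ((isClosed_le continuous_re continuous_const).inter
      (isClosed_iInter fun i => isClosed_iInter fun _ =>
        isClosed_le continuous_const (continuous_arcDist i)))

theorem openHalfPolygon_subset (M : ℕ) : openHalfPolygon M ⊆ halfPolygon M := fun τ h =>
  (mem_halfPolygon_iff M τ).2 ⟨h.1.le, h.2.1.le, fun i hi => (h.2.2 i hi).le⟩

/-- An interior point can be moved slightly left, right and down within the polygon. These moves
give strictness at the left ray, the right ray and the arcs respectively. -/
theorem interior_halfPolygon (M : ℕ) : interior (halfPolygon M) = openHalfPolygon M := by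
  refine subset_antisymm ?_ (interior_maximal (openHalfPolygon_subset M) (isOpen_openHalfPolygon M))
  intro τ hτ
  have ho : IsOpen ((↑) '' interior (halfPolygon M) : Set ℂ) :=
    isOpenEmbedding_coe.isOpenMap _ isOpen_interior
  obtain ⟨ε, hε, hball⟩ := Metric.isOpen_iff.1 ho τ ⟨τ, hτ, rfl⟩
  have key : ∀ z : ℂ, ‖z‖ < ε → ∃ σ ∈ halfPolygon M, (σ : ℂ) = τ + z := fun z hz => by
    obtain ⟨σ, hσ, e⟩ := hball (Metric.mem_ball.2 (show dist ((τ : ℂ) + z) τ < ε by simpa using hz))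
    exact ⟨σ, interior_subset hσ, e⟩
  have hε2 : ‖((ε / 2 : ℝ) : ℂ)‖ < ε := by
    rw [Complex.norm_real, Real.norm_of_nonneg (by positivity)]
    linarith
  refine ⟨?_, ?_, fun i hi => ?_⟩
  · obtain ⟨σ, hσ, e⟩ := key (-(ε / 2 : ℝ)) (by rwa [norm_neg])
    have h1 := ((mem_halfPolygon_iff M σ).1 hσ).1
    have h2 := congrArg Complex.re e
    rw [Complex.add_re, Complex.neg_re, Complex.ofReal_re, coe_re, coe_re] at h2
    linarith
  · obtain ⟨σ, hσ, e⟩ := key (ε / 2 : ℝ) hε2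
    have h1 := ((mem_halfPolygon_iff M σ).1 hσ).2.1
    have h2 := congrArg Complex.re e
    rw [Complex.add_re, Complex.ofReal_re, coe_re, coe_re] at h2
    linarith
  · obtain ⟨σ, hσ, e⟩ := key (-(ε / 2 : ℝ) * Complex.I)
      (by rwa [norm_mul, Complex.norm_I, mul_one, norm_neg])
    have h1 := ((mem_halfPolygon_iff M σ).1 hσ).2.2 i hi
    have h2 := congrArg Complex.re e
    have h3 := congrArg Complex.im e
    simp only [Complex.add_re, Complex.add_im, Complex.mul_re, Complex.mul_im, Complex.neg_re,
      Complex.neg_im, Complex.ofReal_re, Complex.ofReal_im, Complex.I_re, Complex.I_im,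
      coe_re, coe_im] at h2 h3
    have h4 := arcDist_sq i σ
    have h5 := arcDist_sq i τ
    have h6 := σ.im_pos
    have h7 := arcDist_nonneg i τ
    rw [show σ.re = τ.re by linarith] at h4
    have h8 : σ.im < τ.im := by linarith
    nlinarith

/-- A boundary point is reached in two limits: moving up leaves every arc, and then a horizontal
move leaves the rays. -/
theorem closure_interior_halfPolygon (M : ℕ) (hM : 0 < M) :
    closure (interior (halfPolygon M)) = halfPolygon M := by
  rw [interior_halfPolygon]
  refine subset_antisymm (closure_minimal (openHalfPolygon_subset M) (isClosed_halfPolygon M)) ?_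
  have hM' : (1 : ℝ) ≤ M := by exact_mod_cast hM
  have step : ∀ τ : ℍ, τ ∈ halfPolygon M → (∀ i < M, 1 < arcDist i τ) →
      τ ∈ closure (openHalfPolygon M) := by
    intro τ hτ hi
    obtain ⟨h1, h2, -⟩ := (mem_halfPolygon_iff M τ).1 hτ
    have hc : Continuous fun s : ℝ => s +ᵥ τ :=
      isEmbedding_coe.continuous_iff.2 (by
        simp only [Function.comp_def, coe_vadd]
        fun_prop)
    have h0 : Filter.Tendsto (fun s : ℝ => s +ᵥ τ) (nhds 0) (nhds τ) := by
      simpa using hc.tendsto 0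
    have hev : ∀ᶠ s : ℝ in nhds 0, ∀ i ∈ Finset.range M, 1 < arcDist i (s +ᵥ τ) := by
      rw [Filter.eventually_all_finset]
      intro i hiM
      exact ((continuous_arcDist i).tendsto τ |>.comp h0).eventually_const_lt
        (hi i (Finset.mem_range.1 hiM))
    rcases lt_or_eq_of_le h2 with h | h
    · refine mem_closure_of_tendsto (h0.mono_left (nhdsWithin_le_nhds (s := Set.Ioi 0))) ?_
      have h3 : ∀ᶠ s : ℝ in nhds 0, s < ((M : ℝ) - 1) / 2 - τ.re := gt_mem_nhds (by linarith)
      filter_upwards [nhdsWithin_le_nhds hev, nhdsWithin_le_nhds h3, self_mem_nhdsWithin]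
        with s hs1 hs2 hs3
      have hs3' : 0 < s := hs3
      refine ⟨?_, ?_, fun i hi => hs1 i (Finset.mem_range.2 hi)⟩ <;> rw [vadd_re] <;> linarith
    -- On the right ray the approach is from the left; there is room because M > 0.
    · refine mem_closure_of_tendsto (h0.mono_left (nhdsWithin_le_nhds (s := Set.Iio 0))) ?_
      have h3 : ∀ᶠ s : ℝ in nhds 0, -1 / 2 - τ.re < s := lt_mem_nhds (by linarith)
      filter_upwards [nhdsWithin_le_nhds hev, nhdsWithin_le_nhds h3, self_mem_nhdsWithin]
        with s hs1 hs2 hs3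
      have hs3' : s < 0 := hs3
      refine ⟨?_, ?_, fun i hi => hs1 i (Finset.mem_range.2 hi)⟩ <;> rw [vadd_re] <;> linarith
  intro τ hτ
  obtain ⟨h1, h2, h3⟩ := (mem_halfPolygon_iff M τ).1 hτ
  -- The absolute value keeps the path in ℍ for every real s, so it is continuous on all of ℝ.
  have hpos : ∀ s : ℝ, 0 < ((τ : ℂ) + (|s| : ℝ) * Complex.I).im := fun s => by
    have := τ.im_pos
    simp
    positivity
  have hc : Continuous fun s : ℝ => UpperHalfPlane.mk ((τ : ℂ) + (|s| : ℝ) * Complex.I) (hpos s) :=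
    isEmbedding_coe.continuous_iff.2 (by
      simp only [Function.comp_def]
      fun_prop)
  have h0 : Filter.Tendsto
      (fun s : ℝ => UpperHalfPlane.mk ((τ : ℂ) + (|s| : ℝ) * Complex.I) (hpos s))
      (nhds 0) (nhds τ) := by
    have := hc.tendsto 0
    simpa using this
  rw [← closure_closure]
  refine mem_closure_of_tendsto (h0.mono_left (nhdsWithin_le_nhds (s := Set.Ioi 0))) ?_
  filter_upwards [self_mem_nhdsWithin] with s hs
  have hs' : 0 < |s| := abs_pos.2 (ne_of_gt hs)
  generalize hσ : UpperHalfPlane.mk ((τ : ℂ) + (|s| : ℝ) * Complex.I) (hpos s) = σ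
  have hre : σ.re = τ.re := by
    rw [← hσ]
    change ((τ : ℂ) + (|s| : ℝ) * Complex.I).re = _
    simp
  have him : σ.im = τ.im + |s| := by
    rw [← hσ]
    change ((τ : ℂ) + (|s| : ℝ) * Complex.I).im = _
    simp
  have hlt : ∀ i < M, 1 < arcDist i σ := by
    intro i hi
    have h4 := arcDist_sq i σ
    have h5 := arcDist_sq i τ
    have h6 := τ.im_pos
    have h7 := arcDist_nonneg i σ
    have h8 := h3 i hi
    rw [hre, him] at h4
    nlinarith
  exact step σ ((mem_halfPolygon_iff M σ).2 ⟨by linarith, by linarith, fun i hi => (hlt i hi).le⟩) hlt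

theorem interior_halfPolygon_nonempty (M : ℕ) (hM : 0 < M) :
    (interior (halfPolygon M)).Nonempty := by
  rw [interior_halfPolygon]
  have hM' : (1 : ℝ) ≤ M := by exact_mod_cast hM
  refine ⟨⟨⟨-1 / 4, 1⟩, one_pos⟩, ?_, ?_, fun i _ => ?_⟩
  · change (-1 / 2 : ℝ) < -1 / 4
    norm_num
  · change (-1 / 4 : ℝ) < _
    linarith
  · have h := arcDist_sq i ⟨⟨-1 / 4, 1⟩, one_pos⟩
    have h1 := arcDist_nonneg i ⟨⟨-1 / 4, 1⟩, one_pos⟩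
    have h2 : (⟨⟨-1 / 4, 1⟩, one_pos⟩ : ℍ).im = 1 := rfl
    rw [h2] at h
    nlinarith

/-! ### Side pairings -/

/-- A family of transformations that pairs the sides of `halfPolygon M` plays ping-pong with its
interior. -/
theorem disjoint_interior_halfPolygon {ι : Type*} [DecidableEq ι] (g : ι → PSL(2, ℝ)) (i₀ : ι)
    (M : ℕ) (u v : ι → ℕ) (h₀ : ∀ τ : ℍ, (g i₀ • τ).re = τ.re + M / 2)
    (hg : ∀ i, i ≠ i₀ → MapsArc (g i) (u i) (v i))
    (hu : ∀ i, i ≠ i₀ → u i < M) (hv : ∀ i, i ≠ i₀ → v i < M)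
    (huu : ∀ i j, i ≠ i₀ → j ≠ i₀ → u i = u j → i = j)
    (hvv : ∀ i j, i ≠ i₀ → j ≠ i₀ → v i = v j → i = j)
    (huv : ∀ i j, i ≠ i₀ → j ≠ i₀ → u i ≠ v j) {w : FreeGroup ι} (hw : w ≠ 1) :
    Disjoint (interior (halfPolygon M)) (FreeGroup.lift g w • interior (halfPolygon M)) := by
  -- Target sets are closed and source sets open, so that each generator maps the whole complement
  -- of its source into its target, and its inverse does the reverse.
  set Z : ι × Bool → Set ℍ := fun p =>
    if p.1 = i₀ then (if p.2 then {τ | ((M : ℝ) - 1) / 2 ≤ τ.re} else {τ | τ.re < -1 / 2})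
    else (if p.2 then {τ | arcDist (u p.1) τ ≤ 1} else {τ | arcDist (v p.1) τ < 1}) with hZdef
  have hin : ∀ i, i ≠ i₀ → ∀ b, ∃ k < M, (k = if b then u i else v i) ∧
      ∀ τ ∈ Z (i, b), arcDist k τ ≤ 1 := by
    intro i hi b
    cases b
    · exact ⟨v i, hv i hi, rfl, fun τ hτ => by simp [hZdef, hi] at hτ; exact hτ.le⟩
    · exact ⟨u i, hu i hi, rfl, fun τ hτ => by simpa [hZdef, hi] using hτ⟩
  have hstrip : ∀ b, ∀ τ ∈ Z (i₀, b), τ.re < -1 / 2 ∨ ((M : ℝ) - 1) / 2 ≤ τ.re := by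
    intro b τ hτ
    cases b
    · exact Or.inl (by simpa [hZdef] using hτ)
    · exact Or.inr (by simpa [hZdef] using hτ)
  have hin' : ∀ k < M, ∀ τ : ℍ, arcDist k τ ≤ 1 → ¬(τ.re < -1 / 2 ∨ ((M : ℝ) - 1) / 2 ≤ τ.re) := by
    intro k hk τ hτ h
    have h1 := abs_lt.1 ((abs_lt_arcDist k τ).trans_le hτ)
    have h2 : (k : ℝ) + 1 ≤ M := by exact_mod_cast hk
    have h3 : (0 : ℝ) ≤ k := k.cast_nonneg
    rcases h with h | h <;> linarith
  rw [interior_halfPolygon]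
  refine FreeGroup.disjoint_lift_smul g Z _ ?_ ?_ ?_ ?_ hw
  · rintro ⟨i, b⟩ ⟨j, b'⟩ hne
    refine Set.disjoint_left.2 fun τ h1 h2 => ?_
    by_cases hi : i = i₀ <;> by_cases hj : j = i₀
    · subst hi hj
      have h3 : (1 : ℝ) ≤ M ∨ (M : ℝ) = 0 := by
        rcases Nat.eq_zero_or_pos M with h | h
        · exact Or.inr (by simp [h])
        · exact Or.inl (by exact_mod_cast h)
      cases b <;> cases b' <;> simp [hZdef] at h1 h2 hne <;> rcases h3 with h3 | h3 <;> linarith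
    · subst hi
      obtain ⟨k, hk, -, h⟩ := hin j hj b'
      exact hin' k hk τ (h τ h2) (hstrip b τ h1)
    · subst hj
      obtain ⟨k, hk, -, h⟩ := hin i hi b
      exact hin' k hk τ (h τ h1) (hstrip b' τ h2)
    · obtain ⟨k, -, hk, h⟩ := hin i hi b
      obtain ⟨l, -, hl, h'⟩ := hin j hj b'
      have e := eq_of_arcDist_le_one (h τ h1) (h' τ h2)
      rw [hk, hl] at e
      cases b <;> cases b' <;> simp at e hne
      · exact hne (hvv i j hi hj e)
      · exact huv j i hj hi e.symm
      · exact huv i j hi hj e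
      · exact hne (huu i j hi hj e)
  · rintro ⟨i, b⟩
    refine Set.disjoint_left.2 fun τ ⟨h1, h2, h3⟩ h4 => ?_
    by_cases hi : i = i₀
    · subst hi
      rcases hstrip b τ h4 with h | h <;> linarith
    · obtain ⟨k, hk, -, h⟩ := hin i hi b
      exact (h3 k hk).not_ge (h τ h4)
  · intro i τ hτ
    by_cases hi : i = i₀
    · subst hi
      simp [hZdef] at hτ ⊢
      rw [h₀]
      linarith
    · simp [hZdef, hi] at hτ ⊢
      exact (hg i hi).smul_le hτ
  · intro i τ hτ
    by_cases hi : i = i₀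
    · subst hi
      have h1 := h₀ ((g i)⁻¹ • τ)
      rw [smul_inv_smul] at h1
      simp [hZdef] at hτ ⊢
      linarith
    · simp [hZdef, hi] at hτ ⊢
      exact (hg i hi).inv_smul_lt hτ

/-! ### The 10-gon and the 18-gon -/

theorem tenGon_eq : tenGon = halfPolygon 8 := rfl

theorem eighteenGon_eq : eighteenGon = halfPolygon 16 := rfl

theorem T_zpow_smul_re (n : ℤ) (τ : ℍ) : (slToPSL (ModularGroup.T ^ n) • τ).re = τ.re + n := by
  rw [slToPSL_smul, ModularGroup.re_T_zpow_smul]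

theorem genV_zero_eq : genV 0 = slToPSL (ModularGroup.T ^ (4 : ℤ)) := by
  rw [genV, matrixV_zero]

theorem genT_zero_eq : genT 0 = slToPSL (ModularGroup.T ^ (8 : ℤ)) := by
  rw [genT_eq.1, genV_zero_eq, ← map_mul, ← zpow_add]
  rfl

theorem genV_zero_smul_re (τ : ℍ) : (genV 0 • τ).re = τ.re + 4 := by
  rw [genV_zero_eq, T_zpow_smul_re]
  norm_num

theorem genT_zero_smul_re (τ : ℍ) : (genT 0 • τ).re = τ.re + 8 := by
  rw [genT_zero_eq, T_zpow_smul_re]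
  norm_num

/-- The entries at index 0 are placeholders, since V₀ pairs the two rays. -/
theorem mapsArc_genV (i : Fin 5) (hi : i ≠ 0) :
    MapsArc (genV i) (![0, 0, 2, 4, 6] i) (![0, 1, 3, 5, 7] i) := by
  fin_cases i
  · exact absurd rfl hi
  · change MapsArc (genV 1) 0 1
    -- V₁ has lower left entry -4; the representative -V₁ has the required 4.
    rw [genV, ← slToPSL_neg]
    exact mapsArc_slToPSL (by decide) (by decide) (by decide)
  · exact mapsArc_slToPSL (by decide) (by decide) (by decide)
  · exact mapsArc_slToPSL (by decide) (by decide) (by decide)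
  · exact mapsArc_slToPSL (by decide) (by decide) (by decide)

theorem mapsArc_genT (i : Fin 9) (hi : i ≠ 0) :
    MapsArc (genT i) (![0, 8, 10, 12, 14, 9, 11, 13, 15] i) (![0, 1, 3, 5, 7, 0, 2, 4, 6] i) := by
  fin_cases i
  · exact absurd rfl hi
  all_goals exact mapsArc_slToPSL (by decide) (by decide) (by decide)

theorem disjoint_interior_tenGon {w : FreeGroup (Fin 5)} (hw : w ≠ 1) :
    Disjoint (interior tenGon) (FreeGroup.lift genV w • interior tenGon) :=
  disjoint_interior_halfPolygon genV 0 8 (![0, 0, 2, 4, 6]) (![0, 1, 3, 5, 7])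
    (fun τ => by rw [genV_zero_smul_re]; norm_num) mapsArc_genV (by decide) (by decide) (by decide)
    (by decide) (by decide) hw

theorem disjoint_interior_eighteenGon {w : FreeGroup (Fin 9)} (hw : w ≠ 1) :
    Disjoint (interior eighteenGon) (FreeGroup.lift genT w • interior eighteenGon) :=
  disjoint_interior_halfPolygon genT 0 16 (![0, 8, 10, 12, 14, 9, 11, 13, 15])
    (![0, 1, 3, 5, 7, 0, 2, 4, 6]) (fun τ => by rw [genT_zero_smul_re]; norm_num) mapsArc_genT
    (by decide) (by decide) (by decide) (by decide) (by decide) hw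

theorem freelyGenerates_genV : FreelyGenerates genV gammaFour :=
  ⟨FreeGroup.lift_injective_of_disjoint genV (interior_halfPolygon_nonempty 8 (by norm_num))
    fun _ hw => disjoint_interior_tenGon hw, closure_range_genV⟩

theorem lift_genT_injective : Function.Injective (FreeGroup.lift genT) :=
  FreeGroup.lift_injective_of_disjoint genT (interior_halfPolygon_nonempty 16 (by norm_num))
    fun _ hw => disjoint_interior_eighteenGon hw

theorem arcDist_genV_zero_smul (i : ℕ) (τ : ℍ) : arcDist (i + 8) (genV 0 • τ) = arcDist i τ := by
  rw [arcDist, arcDist, genV_zero_eq, slToPSL_smul, T_zpow_four_smul_coe]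
  congr 1
  push_cast
  ring

theorem one_le_arcDist_of_le {i : ℕ} {τ : ℍ} (h : τ.re ≤ ((i : ℝ) - 1) / 2) : 1 ≤ arcDist i τ := by
  have h1 := abs_lt_arcDist i τ
  have h2 := neg_abs_le (4 * τ.re - (2 * i - 1))
  linarith

theorem one_le_arcDist_of_ge {i : ℕ} {τ : ℍ} (h : (i : ℝ) / 2 ≤ τ.re) : 1 ≤ arcDist i τ := by
  have h1 := abs_lt_arcDist i τ
  have h2 := le_abs_self (4 * τ.re - (2 * i - 1))
  linarith

theorem mem_tenGon_iff (τ : ℍ) :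
    τ ∈ tenGon ↔ -1 / 2 ≤ τ.re ∧ τ.re ≤ 7 / 2 ∧ ∀ i < 8, 1 ≤ arcDist i τ := by
  rw [tenGon_eq, mem_halfPolygon_iff]
  norm_num

theorem mem_eighteenGon_iff (τ : ℍ) :
    τ ∈ eighteenGon ↔ -1 / 2 ≤ τ.re ∧ τ.re ≤ 15 / 2 ∧ ∀ i < 16, 1 ≤ arcDist i τ := by
  rw [eighteenGon_eq, mem_halfPolygon_iff]
  norm_num

/-- The cut is at Re τ = 7/2; on either side the arcs of the other half impose no condition. -/
theorem eighteenGon_eq_union : eighteenGon = tenGon ∪ genV 0 • tenGon := by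
  ext τ
  have hre := genV_zero_smul_re ((genV 0)⁻¹ • τ)
  have hd := fun i => arcDist_genV_zero_smul i ((genV 0)⁻¹ • τ)
  simp only [smul_inv_smul] at hre hd
  rw [Set.mem_union, Set.mem_smul_set_iff_inv_smul_mem, mem_tenGon_iff, mem_tenGon_iff,
    mem_eighteenGon_iff]
  constructor
  · rintro ⟨h1, h2, h3⟩
    rcases le_total τ.re (7 / 2) with h | h
    · exact Or.inl ⟨h1, h, fun i hi => h3 i (by omega)⟩
    · exact Or.inr ⟨by linarith, by linarith, fun i hi => hd i ▸ h3 (i + 8) (by omega)⟩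
  · rintro (⟨h1, h2, h3⟩ | ⟨h1, h2, h3⟩)
    · refine ⟨h1, by linarith, fun i hi => ?_⟩
      rcases lt_or_ge i 8 with h | h
      · exact h3 i h
      · refine one_le_arcDist_of_le (h2.trans ?_)
        have : (8 : ℝ) ≤ i := by exact_mod_cast h
        linarith
    · refine ⟨by linarith, by linarith, fun i hi => ?_⟩
      rcases lt_or_ge i 8 with h | h
      · refine one_le_arcDist_of_ge ?_
        have : (i : ℝ) + 1 ≤ 8 := by exact_mod_cast h
        linarith
      · obtain ⟨j, rfl⟩ := Nat.exists_eq_add_of_le' h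
        exact hd j ▸ h3 j (by omega)

/-! ### Every orbit of `Γ(4)` meets the 10-gon -/

/-- The matrices with off-diagonal entries divisible by `4`, that is, `± Γ(4)`. -/
def pmGammaFour : Subgroup SL(2, ℤ) where
  carrier := {γ | (4 : ℤ) ∣ γ 0 1 ∧ (4 : ℤ) ∣ γ 1 0}
  one_mem' := by simp
  mul_mem' := fun {γ δ} hγ hδ => by
    refine ⟨?_, ?_⟩ <;> rw [sl_mul_apply]
    · exact dvd_add (hδ.1.mul_left _) (hγ.1.mul_right _)
    · exact dvd_add (hγ.2.mul_right _) (hδ.2.mul_left _)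
  inv_mem' := fun {γ} hγ => by
    rw [Set.mem_ofPred_eq, Matrix.SpecialLinearGroup.SL2_inv_expl]
    simpa using hγ

theorem slToPSL_mem_of_mem_pmGammaFour {γ : SL(2, ℤ)} (h : γ ∈ pmGammaFour) :
    slToPSL γ ∈ gammaFour := slToPSL_mem_gammaFour h.1 h.2

/-- The imaginary part is Im τ/|cτ + d|², and |cτ + d|² attains a minimum on any nonempty set of
integral bottom rows. -/
theorem exists_max_im_pmGammaFour (τ : ℍ) :
    ∃ γ ∈ pmGammaFour, ∀ δ ∈ pmGammaFour, (δ • τ).im ≤ (γ • τ).im := by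
  let s : Set (Fin 2 → ℤ) := {p | ∃ γ ∈ pmGammaFour, γ 1 = p}
  have hs : s.Nonempty := ⟨_, 1, one_mem _, rfl⟩
  obtain ⟨p, ⟨γ, hγ, rfl⟩, hp⟩ :=
    Filter.Tendsto.exists_within_forall_le hs (ModularGroup.tendsto_normSq_coprime_pair τ)
  refine ⟨γ, hγ, fun δ hδ => ?_⟩
  rw [ModularGroup.im_smul_eq_div_normSq, ModularGroup.im_smul_eq_div_normSq,
    div_le_div_iff_of_pos_left]
  · simpa using! hp (δ 1) ⟨δ, hδ, rfl⟩
  · exact τ.im_pos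
  · exact normSq_denom_pos δ τ.im_ne_zero
  · exact normSq_denom_pos γ τ.im_ne_zero

theorem one_le_norm_of_im_smul_le {γ : SL(2, ℤ)} {τ : ℍ} (h : (γ • τ).im ≤ τ.im) :
    1 ≤ ‖(γ 1 0 : ℂ) * τ + γ 1 1‖ := by
  rw [ModularGroup.im_smul_eq_div_normSq, ModularGroup.denom_apply,
    div_le_iff₀ (by rw [← ModularGroup.denom_apply]; exact normSq_denom_pos γ τ.im_ne_zero),
    Complex.normSq_eq_norm_sq] at h
  have h1 := τ.im_pos
  have h2 := norm_nonneg ((γ 1 0 : ℂ) * τ + γ 1 1)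
  by_contra! h3
  have : τ.im * ‖(γ 1 0 : ℂ) * τ + γ 1 1‖ ^ 2 < τ.im * 1 :=
    mul_lt_mul_of_pos_left (by nlinarith) h1
  linarith

/-- Every arc of the polygon is an isometric circle of an element of ±Γ(4), so maximality of the
imaginary part places a point outside all of them. -/
theorem exists_mem_pmGammaFour_row (i : ℕ) : ∃ γ ∈ pmGammaFour, ∀ τ : ℍ,
    ‖(γ 1 0 : ℂ) * τ + γ 1 1‖ = arcDist i τ := by
  have hU : ∀ k ε, matrixU k ε ∈ pmGammaFour := fun k ε =>
    ⟨⟨ε * k ^ 2, by simp [matrixU]; ring⟩, ⟨-ε, by simp [matrixU]⟩⟩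
  rcases Nat.even_or_odd' i with ⟨k, rfl | rfl⟩
  · refine ⟨matrixU k (-1), hU _ _, fun τ => ?_⟩
    rw [arcDist]
    congr 1
    simp [matrixU]
    ring
  · refine ⟨matrixU k 1, hU _ _, fun τ => ?_⟩
    rw [arcDist, ← norm_neg]
    congr 1
    simp [matrixU]
    ring

theorem exists_smul_mem_tenGon (τ : ℍ) : ∃ g ∈ gammaFour, g • τ ∈ tenGon := by
  obtain ⟨γ, hγ, hmax⟩ := exists_max_im_pmGammaFour τ
  -- The translation by 4q brings the real part into [-1/2, 7/2) without changing the maximal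
  -- imaginary part.
  set q : ℤ := -⌊((γ • τ).re + 1 / 2) / 4⌋ with hq
  have hT : ModularGroup.T ^ (4 * q) ∈ pmGammaFour := by
    refine ⟨?_, ?_⟩ <;> rw [coe_T_zpow_four_mul] <;> simp
  refine ⟨slToPSL (ModularGroup.T ^ (4 * q) * γ),
    slToPSL_mem_of_mem_pmGammaFour (mul_mem hT hγ), ?_⟩
  rw [slToPSL_smul, mem_tenGon_iff]
  have hre : ((ModularGroup.T ^ (4 * q) * γ) • τ).re = (γ • τ).re + 4 * q := by
    rw [mul_smul, ModularGroup.re_T_zpow_smul]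
    push_cast
    ring
  have him : ((ModularGroup.T ^ (4 * q) * γ) • τ).im = (γ • τ).im := by
    rw [mul_smul, ModularGroup.im_T_zpow_smul]
  have h1 := Int.floor_le (((γ • τ).re + 1 / 2) / 4)
  have h2 := Int.lt_floor_add_one (((γ • τ).re + 1 / 2) / 4)
  have hq' : (q : ℝ) = -(⌊((γ • τ).re + 1 / 2) / 4⌋ : ℤ) := by rw [hq]; push_cast; rfl
  refine ⟨by rw [hre, hq']; linarith, by rw [hre, hq']; linarith, fun i _ => ?_⟩
  obtain ⟨δ, hδ, h⟩ := exists_mem_pmGammaFour_row i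
  rw [← h]
  refine one_le_norm_of_im_smul_le ?_
  rw [him, ← mul_smul]
  exact hmax _ (mul_mem hδ (mul_mem hT hγ))

theorem isFundamentalRegion_eighteenGon :
    IsFundamentalRegion (Subgroup.closure (Set.range genT)) eighteenGon := by
  refine ⟨interior_halfPolygon_nonempty 16 (by norm_num),
    closure_interior_halfPolygon 16 (by norm_num), ?_, ?_⟩
  · refine Set.eq_univ_of_forall fun τ => Set.mem_iUnion₂.2 ?_
    obtain ⟨g, hg, hτ⟩ := exists_smul_mem_tenGon τ
    rcases mem_or_genV_zero_mul_mem hg with h | h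
    · refine ⟨g⁻¹, inv_mem h, Set.mem_inv_smul_set_iff.2 ?_⟩
      rw [eighteenGon_eq_union]
      exact Or.inl hτ
    · refine ⟨_, inv_mem h, Set.mem_inv_smul_set_iff.2 ?_⟩
      rw [eighteenGon_eq_union, mul_smul]
      exact Or.inr (Set.smul_mem_smul_set hτ)
  · intro g hg hne
    rw [← FreeGroup.range_lift_eq_closure] at hg
    obtain ⟨w, rfl⟩ := hg
    exact disjoint_interior_eighteenGon fun h => hne (by rw [h, map_one])

theorem genT_zero_smul_geodesicRay :
    genT 0 • geodesicRay (-1 / 2) = geodesicRay (15 / 2) := by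
  ext τ
  have hre := genT_zero_smul_re ((genT 0)⁻¹ • τ)
  rw [smul_inv_smul] at hre
  rw [Set.mem_smul_set_iff_inv_smul_mem, geodesicRay, geodesicRay, Set.mem_ofPred_eq,
    Set.mem_ofPred_eq]
  constructor <;> intro h <;> linarith

theorem genT_smul_arcSide :
    genT 1 • arcSide 1 = arcSide 8 ∧ genT 5 • arcSide 0 = arcSide 9 ∧
      genT 2 • arcSide 3 = arcSide 10 ∧ genT 6 • arcSide 2 = arcSide 11 ∧
      genT 3 • arcSide 5 = arcSide 12 ∧ genT 7 • arcSide 4 = arcSide 13 ∧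
      genT 4 • arcSide 7 = arcSide 14 ∧ genT 8 • arcSide 6 = arcSide 15 :=
  ⟨(mapsArc_genT 1 (by decide)).smul_arcSide, (mapsArc_genT 5 (by decide)).smul_arcSide,
    (mapsArc_genT 2 (by decide)).smul_arcSide, (mapsArc_genT 6 (by decide)).smul_arcSide,
    (mapsArc_genT 3 (by decide)).smul_arcSide, (mapsArc_genT 7 (by decide)).smul_arcSide,
    (mapsArc_genT 4 (by decide)).smul_arcSide, (mapsArc_genT 8 (by decide)).smul_arcSide⟩

/-! ### Cosets of `± Γ(4)` in the modular group -/

theorem mul_T_zpow_apply (γ : SL(2, ℤ)) (n : ℤ) (i : Fin 2) :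
    (γ * ModularGroup.T ^ n) i 0 = γ i 0 ∧ (γ * ModularGroup.T ^ n) i 1 = γ i 0 * n + γ i 1 := by
  rw [sl_mul_apply, sl_mul_apply, ModularGroup.coe_T_zpow]
  simp

theorem mul_S_inv_apply (γ : SL(2, ℤ)) (i : Fin 2) :
    (γ * ModularGroup.S⁻¹) i 0 = -γ i 1 ∧ (γ * ModularGroup.S⁻¹) i 1 = γ i 0 := by
  rw [sl_mul_apply, sl_mul_apply, Matrix.SpecialLinearGroup.SL2_inv_expl]
  simp [ModularGroup.S]

theorem four_dvd_one_sub_sq {a : ℤ} (ha : Odd a) : (4 : ℤ) ∣ 1 - a ^ 2 := by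
  obtain ⟨k, rfl⟩ := ha
  exact ⟨-(k ^ 2 + k), by ring⟩

/-- Since a is odd, a² ≡ 1 mod 4, and multiplying by T to the power -ab changes b into b(1 - a²). -/
theorem exists_eq_mul_T_zpow {γ : SL(2, ℤ)} (hc : 4 ∣ γ 1 0) :
    ∃ h ∈ pmGammaFour, ∃ j : ℤ, γ = h * ModularGroup.T ^ j := by
  have hdet := γ.det_coe
  rw [Matrix.det_fin_two] at hdet
  have ha : Odd (γ 0 0) := by
    obtain ⟨c, hc⟩ := hc
    have : Odd (γ 0 0 * γ 1 1) := ⟨2 * c * γ 0 1, by rw [hc] at hdet; linear_combination hdet⟩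
    exact (Int.odd_mul.1 this).1
  refine ⟨γ * ModularGroup.T ^ (-(γ 0 0 * γ 0 1)), ⟨?_, ?_⟩, γ 0 0 * γ 0 1, ?_⟩
  · rw [(mul_T_zpow_apply _ _ _).2]
    obtain ⟨k, hk⟩ := four_dvd_one_sub_sq ha
    exact ⟨γ 0 1 * k, by linear_combination γ 0 1 * hk⟩
  · rwa [(mul_T_zpow_apply _ _ _).1]
  · rw [mul_assoc, ← zpow_add, neg_add_cancel, zpow_zero, mul_one]

/-- The cases are c ≡ 0, c odd and c ≡ 2 modulo 4. They correspond to w ∘ γ tending at i∞ to 0, to a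
fourth root of unity, and to ∞. -/
theorem sl2z_cases (γ : SL(2, ℤ)) : ∃ h ∈ pmGammaFour, ∃ j : ℤ,
    γ = h * ModularGroup.T ^ j ∨
    (∃ k : ℤ, γ = h * ModularGroup.T ^ j * ModularGroup.S * ModularGroup.T ^ k) ∨
    γ = h * ModularGroup.T ^ j * ModularGroup.S * ModularGroup.T ^ (2 : ℤ) * ModularGroup.S := by
  have hdet := γ.det_coe
  rw [Matrix.det_fin_two] at hdet
  rcases Int.even_or_odd (γ 1 0) with he | ho
  · by_cases h4 : (4 : ℤ) ∣ γ 1 0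
    · obtain ⟨h, hh, j, e⟩ := exists_eq_mul_T_zpow h4
      exact ⟨h, hh, j, Or.inl e⟩
    · have hd : Odd (γ 1 1) := by
        have : Odd (γ 0 0 * γ 1 1) := by
          obtain ⟨c, hc⟩ := he
          exact ⟨c * γ 0 1, by rw [hc] at hdet; linear_combination hdet⟩
        exact (Int.odd_mul.1 this).2
      have hc : (4 : ℤ) ∣ (γ * ModularGroup.S⁻¹ * ModularGroup.T ^ (-2 : ℤ) *
          ModularGroup.S⁻¹) 1 0 := by
        rw [(mul_S_inv_apply _ _).1, (mul_T_zpow_apply _ _ _).2, (mul_S_inv_apply _ _).1,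
          (mul_S_inv_apply _ _).2]
        obtain ⟨c, hc⟩ := he
        obtain ⟨d, hd⟩ := hd
        omega
      obtain ⟨h, hh, j, e⟩ := exists_eq_mul_T_zpow hc
      refine ⟨h, hh, j, Or.inr (Or.inr ?_)⟩
      rw [← e, zpow_neg]
      group
  · have hc : (4 : ℤ) ∣ (γ * ModularGroup.T ^ (-(γ 1 0 * γ 1 1)) * ModularGroup.S⁻¹) 1 0 := by
      rw [(mul_S_inv_apply _ _).1, (mul_T_zpow_apply _ _ _).2]
      obtain ⟨k, hk⟩ := four_dvd_one_sub_sq ho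
      exact ⟨-γ 1 1 * k, by linear_combination -γ 1 1 * hk⟩
    obtain ⟨h, hh, j, e⟩ := exists_eq_mul_T_zpow hc
    refine ⟨h, hh, j, Or.inr (Or.inl ⟨γ 1 0 * γ 1 1, ?_⟩)⟩
    rw [← e, zpow_neg]
    group

theorem octahedralW_pmGammaFour_smul {h : SL(2, ℤ)} (hh : h ∈ pmGammaFour) (τ : ℍ) :
    octahedralW (h • τ : ℍ) = octahedralW τ :=
  gammaFour_le_automorphismGroup_octahedralW (slToPSL_mem_of_mem_pmGammaFour hh) τ

/-! ### The octahedral invariant -/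

/-- The invariant of the octahedral group. -/
noncomputable def octahedralJ (w : ℂ) : ℂ := (w ^ 8 + 14 * w ^ 4 + 1) ^ 3 / (w ^ 5 - w) ^ 4

theorem octahedralJ_neg (w : ℂ) : octahedralJ (-w) = octahedralJ w := by
  rw [octahedralJ, octahedralJ]
  ring_nf

theorem octahedralW_pow_five_sub_ne_zero (τ : ℍ) : octahedralW τ ^ 5 - octahedralW τ ≠ 0 := by
  rw [show octahedralW τ ^ 5 - octahedralW τ = octahedralW τ * (octahedralW τ ^ 4 - 1) by ring]
  exact mul_ne_zero (octahedralW_ne_zero τ.im_pos)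
    (sub_ne_zero.2 (octahedralW_pow_four_ne_one τ.im_pos))

theorem octahedralJ_T_smul (τ : ℍ) :
    octahedralJ (octahedralW (ModularGroup.T • τ : ℍ)) = octahedralJ (octahedralW τ) := by
  rw [octahedralW_T_smul, octahedralJ, octahedralJ]
  have h4 := Complex.I_pow_four
  have e8 : (Complex.I * octahedralW τ) ^ 8 = octahedralW τ ^ 8 := by
    linear_combination octahedralW τ ^ 8 * (Complex.I ^ 4 + 1) * h4
  have e4 : (Complex.I * octahedralW τ) ^ 4 = octahedralW τ ^ 4 := by
    linear_combination octahedralW τ ^ 4 * h4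
  have e5 : (Complex.I * octahedralW τ) ^ 5 - Complex.I * octahedralW τ =
      Complex.I * (octahedralW τ ^ 5 - octahedralW τ) := by
    linear_combination Complex.I * octahedralW τ ^ 5 * h4
  rw [e8, e4, e5, mul_pow Complex.I, h4, one_mul]

theorem octahedralJ_S_smul (τ : ℍ) :
    octahedralJ (octahedralW (ModularGroup.S • τ : ℍ)) = octahedralJ (octahedralW τ) := by
  rw [octahedralW_S_smul]
  have h1 := one_add_octahedralW_ne_zero τ.im_pos
  have h5 := octahedralW_pow_five_sub_ne_zero τ
  generalize octahedralW τ = w at *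
  -- The constants 16 here and 8 below cancel in the invariant because 16³ = 8⁴.
  have e1 : ((1 - w) / (1 + w)) ^ 8 + 14 * ((1 - w) / (1 + w)) ^ 4 + 1 =
      16 * (w ^ 8 + 14 * w ^ 4 + 1) / (1 + w) ^ 8 := by
    field_simp
    ring
  have e2 : ((1 - w) / (1 + w)) ^ 5 - (1 - w) / (1 + w) = 8 * (w ^ 5 - w) / (1 + w) ^ 6 := by
    field_simp
    ring
  rw [octahedralJ, octahedralJ, e1, e2]
  field_simp
  norm_num
  ring

theorem octahedralJ_smul (γ : SL(2, ℤ)) (τ : ℍ) :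
    octahedralJ (octahedralW (γ • τ : ℍ)) = octahedralJ (octahedralW τ) := by
  have hγ : γ ∈ Subgroup.closure {ModularGroup.S, ModularGroup.T} := by
    rw [SpecialLinearGroup.SL2Z_generators]
    exact Subgroup.mem_top γ
  induction hγ using Subgroup.closure_induction generalizing τ with
  | mem γ h =>
    rcases h with rfl | rfl
    · exact octahedralJ_S_smul τ
    · exact octahedralJ_T_smul τ
  | one => rw [one_smul]
  | mul γ δ _ _ hγ hδ => rw [mul_smul, hγ, hδ]
  | inv γ _ hγ => rw [← hγ, smul_inv_smul]

theorem octahedralJ_burnsideX (τ : ℍ) :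
    octahedralJ (burnsideX τ) = octahedralJ (octahedralW τ) := by
  rw [burnsideX_eq_neg_octahedralW, octahedralJ_neg, octahedralJ_S_smul]

theorem continuous_octahedralJ : Continuous fun τ : ℍ => octahedralJ (octahedralW τ) := by
  have hw := continuous_octahedralW
  exact (((((hw.pow 8).add (continuous_const.mul (hw.pow 4))).add continuous_const).pow 3).div
    (((hw.pow 5).sub hw).pow 4) fun τ => pow_ne_zero 4 (octahedralW_pow_five_sub_ne_zero τ))

/-- If the octahedral invariant is large then some translate is near the cusp `i ∞`. -/
theorem exists_lt_im_smul (Y : ℝ) : ∃ B : ℝ, ∀ τ : ℍ, B < ‖octahedralJ (octahedralW τ)‖ →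
    ∃ γ : SL(2, ℤ), Y < (γ • τ).im := by
  obtain ⟨B, hB⟩ := (ModularGroup.isCompact_truncatedFundamentalDomain Y).exists_bound_of_continuousOn
    continuous_octahedralJ.continuousOn
  refine ⟨B, fun τ hτ => ?_⟩
  obtain ⟨γ, hγ⟩ := ModularGroup.exists_smul_mem_fd τ
  refine ⟨γ, ?_⟩
  by_contra! h
  have := hB (γ • τ) ⟨hγ, h⟩
  rw [octahedralJ_smul] at this
  linarith

/-- The denominator of the invariant vanishes only at the finite vertices; there the numerator is
nonzero. -/
theorem exists_lt_norm_octahedralJ (B : ℝ) : ∃ ε > 0, ∀ x : ℂ, x ^ 5 - x ≠ 0 →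
    ‖x ^ 5 - x‖ < ε → B < ‖octahedralJ x‖ := by
  -- With s = x⁴, smallness of |s||s - 1|⁴ puts s near 0 or near 1, where s² + 14s + 1 is near 1 or
  -- 16.
  have hlow : ∀ x : ℂ, ‖x ^ 5 - x‖ < 1 / 20 → 1 / 4 ≤ ‖x ^ 8 + 14 * x ^ 4 + 1‖ := by
    intro x hx
    have e4 : ‖x ^ 5 - x‖ ^ 4 = ‖x ^ 4‖ * ‖x ^ 4 - 1‖ ^ 4 := by
      rw [← norm_pow, ← norm_pow, ← norm_mul]
      ring_nf
    have h4 : ‖x ^ 5 - x‖ ^ 4 < (1 / 20) ^ 4 := pow_lt_pow_left₀ hx (norm_nonneg _) four_ne_zero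
    rw [show x ^ 8 + 14 * x ^ 4 + 1 = (x ^ 4) ^ 2 + 14 * x ^ 4 + 1 by ring]
    rw [e4] at h4
    generalize x ^ 4 = s at *
    rcases le_or_gt ‖s‖ (1 / 20) with hs | hs
    · have h1 : ‖(1 : ℂ)‖ ≤ ‖s ^ 2 + 14 * s + 1‖ + ‖s ^ 2 + 14 * s‖ := by
        have := norm_sub_le (s ^ 2 + 14 * s + 1) (s ^ 2 + 14 * s)
        rwa [add_sub_cancel_left] at this
      have h2 := norm_add_le (s ^ 2) (14 * s)
      rw [norm_pow, norm_mul] at h2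
      norm_num at h1 h2
      have := norm_nonneg s
      nlinarith
    · have h0 := norm_nonneg (s - 1)
      have h1 : ‖s - 1‖ ^ 4 < (1 / 8) ^ 4 := by
        have := pow_nonneg h0 4
        nlinarith
      have h2 : ‖s - 1‖ < 1 / 8 := lt_of_pow_lt_pow_left₀ 4 (by norm_num) h1
      have h3 : ‖(16 : ℂ)‖ ≤ ‖s ^ 2 + 14 * s + 1‖ + ‖(s - 1) ^ 2 + 16 * (s - 1)‖ := by
        have := norm_sub_le (s ^ 2 + 14 * s + 1) ((s - 1) ^ 2 + 16 * (s - 1))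
        rwa [show s ^ 2 + 14 * s + 1 - ((s - 1) ^ 2 + 16 * (s - 1)) = 16 by ring] at this
      have h5 := norm_add_le ((s - 1) ^ 2) (16 * (s - 1))
      rw [norm_pow, norm_mul] at h5
      norm_num at h3 h5
      nlinarith
  have hB : 0 < |B| + 1 := by positivity
  -- The 64 comes from cubing the lower bound 1/4 for the numerator.
  refine ⟨min (1 / 20) (1 / (64 * (|B| + 1))), by positivity, fun x hne hx => ?_⟩
  obtain ⟨hx1, hx2⟩ := lt_min_iff.1 hx
  have hpos : 0 < ‖x ^ 5 - x‖ := norm_pos_iff.2 hne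
  rw [octahedralJ, norm_div, norm_pow, norm_pow, lt_div_iff₀ (by positivity)]
  have h1 : (1 / 4 : ℝ) ^ 3 ≤ ‖x ^ 8 + 14 * x ^ 4 + 1‖ ^ 3 :=
    pow_le_pow_left₀ (by norm_num) (hlow x hx1) 3
  have h2 : ‖x ^ 5 - x‖ ^ 4 ≤ ‖x ^ 5 - x‖ := pow_le_of_le_one hpos.le (by linarith) four_ne_zero
  rw [lt_div_iff₀ (by positivity)] at hx2
  have h3 := le_abs_self B
  have h4 : 0 < ‖x ^ 5 - x‖ ^ 4 := by positivity
  nlinarith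

/-! ### Behaviour at the cusp `i ∞` -/

section Cusp

open Filter Topology

/-- The nome `exp (π i τ / 2)`. -/
noncomputable def nome (τ : ℍ) : ℂ := Complex.exp (Real.pi * Complex.I * τ / 2)

theorem nome_ne_zero (τ : ℍ) : nome τ ≠ 0 := Complex.exp_ne_zero _

theorem norm_nome (τ : ℍ) : ‖nome τ‖ = Real.exp (-(Real.pi / 2) * τ.im) := by
  rw [nome, Complex.norm_exp]
  congr 1
  simp
  ring

theorem tendsto_im_atImInfty : Tendsto UpperHalfPlane.im atImInfty atTop := tendsto_comap

theorem tendsto_nome : Tendsto nome atImInfty (𝓝 0) := by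
  rw [tendsto_zero_iff_norm_tendsto_zero]
  simp only [norm_nome]
  exact Real.tendsto_exp_atBot.comp
    (tendsto_im_atImInfty.const_mul_atTop_of_neg (by linarith [Real.pi_pos]))

theorem tendsto_octahedralW_div : Tendsto (fun τ : ℍ => octahedralW τ / nome τ) atImInfty (𝓝 2) := by
  have h2 : Tendsto (fun τ : ℍ => 2 * (τ : ℂ)) atImInfty (comap Complex.im atTop) := by
    rw [tendsto_comap_iff]
    have : Complex.im ∘ (fun τ : ℍ => 2 * (τ : ℂ)) = fun τ => 2 * τ.im := by
      ext τ
      simp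
    rw [this]
    exact tendsto_im_atImInfty.const_mul_atTop two_pos
  have h := (tendsto_jacobiTheta₂_half.comp h2).div (tendsto_jacobiTheta₂_zero.comp h2) one_ne_zero
  rw [div_one] at h
  refine h.congr fun τ => ?_
  have := nome_ne_zero τ
  simp only [Function.comp, Pi.div_apply, octahedralW, theta2, theta3]
  rw [show Real.pi * Complex.I * (2 * (τ : ℂ)) / 4 = Real.pi * Complex.I * τ / 2 by ring, ← nome]
  field_simp

theorem tendsto_octahedralW : Tendsto (fun τ : ℍ => octahedralW τ) atImInfty (𝓝 0) := by
  have h := tendsto_octahedralW_div.mul tendsto_nome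
  rw [mul_zero] at h
  exact h.congr fun τ => div_mul_cancel₀ _ (nome_ne_zero τ)

theorem tendsto_burnsideY_sq_div :
    Tendsto (fun τ : ℍ => burnsideY τ ^ 2 / nome τ) atImInfty (𝓝 16) := by
  have hw := tendsto_octahedralW
  have h1 : Tendsto (fun τ : ℍ => 8 * (1 - octahedralW τ ^ 4) / (1 + octahedralW τ) ^ 6) atImInfty
      (𝓝 (8 * (1 - 0 ^ 4) / (1 + 0) ^ 6)) :=
    (((hw.pow 4).const_sub 1).const_mul 8).div ((hw.const_add 1).pow 6) (by norm_num)
  have h := h1.mul tendsto_octahedralW_div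
  norm_num at h
  refine h.congr fun τ => ?_
  rw [burnsideY_sq_eq τ.im_pos]
  have := nome_ne_zero τ
  have := one_add_octahedralW_ne_zero τ.im_pos
  field_simp

theorem tendsto_burnsideY_sq : Tendsto (fun τ : ℍ => burnsideY τ ^ 2) atImInfty (𝓝 0) := by
  have h := tendsto_burnsideY_sq_div.mul tendsto_nome
  rw [mul_zero] at h
  exact h.congr fun τ => div_mul_cancel₀ _ (nome_ne_zero τ)

theorem eq_zero_of_tendsto_exp_mul_im {k L : ℝ} (hL : L ≠ 0)
    (h : Tendsto (fun τ : ℍ => Real.exp (k * τ.im)) atImInfty (𝓝 L)) : k = 0 ∧ L = 1 := by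
  have hk : k = 0 := by
    rcases lt_trichotomy k 0 with hk | hk | hk
    · exact absurd (tendsto_nhds_unique h (Real.tendsto_exp_atBot.comp
        (tendsto_im_atImInfty.const_mul_atTop_of_neg hk))) hL
    · exact hk
    · exact absurd h (not_tendsto_nhds_of_tendsto_atTop (Real.tendsto_exp_atTop.comp
        (tendsto_im_atImInfty.const_mul_atTop hk)) L)
  refine ⟨hk, ?_⟩
  simp only [hk, zero_mul, Real.exp_zero] at h
  exact (tendsto_nhds_unique h tendsto_const_nhds)

/-! ### Automorphisms of `φ` fix the cusp `i ∞` up to the modular group -/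

/-- The point `exp s * i` of the imaginary axis. -/
noncomputable def imaginaryAxis (s : ℝ) : ℍ :=
  UpperHalfPlane.mk ((Real.exp s : ℝ) * Complex.I) (by
    rw [Complex.im_ofReal_mul, Complex.I_im, mul_one]
    exact Real.exp_pos s)

theorem imaginaryAxis_im (s : ℝ) : (imaginaryAxis s).im = Real.exp s := by
  change ((Real.exp s : ℝ) * Complex.I : ℂ).im = _
  rw [Complex.im_ofReal_mul, Complex.I_im, mul_one]

theorem continuous_imaginaryAxis : Continuous imaginaryAxis :=
  isEmbedding_coe.continuous_iff.2 (by
    change Continuous fun s : ℝ => ((Real.exp s : ℝ) * Complex.I : ℂ)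
    fun_prop)

theorem tendsto_imaginaryAxis : Tendsto imaginaryAxis atTop atImInfty := by
  refine tendsto_comap_iff.2 ?_
  simp only [Function.comp_def, imaginaryAxis_im]
  exact Real.tendsto_exp_atTop

theorem sl_im_smul (g : SL(2, ℝ)) (τ : ℍ) :
    (g • τ).im = τ.im / ((g 1 0 * τ.re + g 1 1) ^ 2 + (g 1 0 * τ.im) ^ 2) := by
  have h : ((g • τ : ℍ) : ℂ) = (g 0 0 * τ + g 0 1) / (g 1 0 * τ + g 1 1) := by
    rw [coe_specialLinearGroup_apply]
    rfl
  have hdet := g.det_coe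
  rw [Matrix.det_fin_two] at hdet
  have h1 := congrArg Complex.im h
  rw [Complex.div_im, ← sub_div] at h1
  rw [← coe_im, h1]
  congr 1
  · simp
    linear_combination τ.im * hdet
  · rw [Complex.normSq_apply]
    simp
    ring

theorem im_smul_mul_le {g : SL(2, ℝ)} (hc : g 1 0 ≠ 0) (τ : ℍ) :
    (g • τ).im * (g 1 0 ^ 2 * τ.im) ≤ 1 := by
  rw [sl_im_smul]
  have h1 := τ.im_pos
  have h2 : 0 < (g 1 0 * τ.im) ^ 2 := by positivity
  rw [div_mul_eq_mul_div, div_le_one (by positivity)]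
  nlinarith [sq_nonneg (g 1 0 * τ.re + g 1 1)]

/-- The matrix of an element of the modular group with real entries. -/
noncomputable def slToReal : SL(2, ℤ) →* SL(2, ℝ) :=
  Matrix.SpecialLinearGroup.map (Int.castRingHom ℝ)

theorem slToReal_smul (γ : SL(2, ℤ)) (τ : ℍ) : slToReal γ • τ = γ • τ := rfl

theorem slToReal_apply (γ : SL(2, ℤ)) (i j : Fin 2) : slToReal γ i j = γ i j := rfl

/-- Two horoballs of height one at distinct cusps are disjoint. -/
theorem eq_zero_of_one_lt_im {γ : SL(2, ℤ)} {τ : ℍ} (h : 1 < τ.im) (h' : 1 < (γ • τ).im) :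
    γ 1 0 = 0 := by
  by_contra hc
  have h1 : slToReal γ 1 0 ≠ 0 := by
    rw [slToReal_apply]
    exact_mod_cast hc
  have h2 := im_smul_mul_le h1 τ
  rw [slToReal_smul, slToReal_apply] at h2
  have h3 : (1 : ℝ) ≤ (γ 1 0 : ℝ) ^ 2 := by
    have : 1 ≤ (γ 1 0) ^ 2 := by
      have := sq_nonneg (γ 1 0)
      have : (γ 1 0) ^ 2 ≠ 0 := pow_ne_zero 2 hc
      omega
    exact_mod_cast this
  have h4 : 1 < (γ 1 0 : ℝ) ^ 2 * τ.im := by nlinarith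
  nlinarith

theorem im_smul_eq_of_eq_zero {γ : SL(2, ℤ)} (hc : γ 1 0 = 0) (τ : ℍ) : (γ • τ).im = τ.im := by
  obtain ⟨n, hn⟩ := ModularGroup.exists_eq_T_zpow_of_c_eq_zero hc
  rw [hn, ModularGroup.im_T_zpow_smul]

/-- The image under g of the upper imaginary axis lies in the union of the modular horoballs of
height one. These are disjoint, so by connectedness it stays in a single one, and a modular γ sends
the base point of that horoball to ∞. If γg had nonzero lower left entry, the imaginary part would
tend to 0 along the axis. -/
theorem exists_upper_triangular {g : SL(2, ℝ)}
    (hg : ∀ τ : ℍ, burnsideY (g • τ : ℍ) = burnsideY τ) :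
    ∃ γ : SL(2, ℤ), (slToReal γ * g) 1 0 = 0 := by
  obtain ⟨B, hB⟩ := exists_lt_im_smul 1
  obtain ⟨ε, hε, hx⟩ := exists_lt_norm_octahedralJ B
  have hlim := (tendsto_burnsideY_sq.comp tendsto_imaginaryAxis).norm
  rw [norm_zero] at hlim
  obtain ⟨s₀, hs₀⟩ := eventually_atTop.1 (hlim.eventually_lt_const hε)
  have hcusp : ∀ s ∈ Set.Ioi s₀, ∃ γ : SL(2, ℤ), 1 < (γ • g • imaginaryAxis s).im := by
    intro s hs
    refine hB _ ?_
    rw [← octahedralJ_burnsideX]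
    have e : burnsideX (g • imaginaryAxis s : ℍ) ^ 5 - burnsideX (g • imaginaryAxis s : ℍ) =
        burnsideY (imaginaryAxis s) ^ 2 := by
      rw [← burnsideY_sq (g • imaginaryAxis s).im_pos, hg]
    refine hx _ ?_ ?_
    · rw [e]
      exact pow_ne_zero 2 (burnsideY_ne_zero (imaginaryAxis s).im_pos)
    · rw [e]
      exact hs₀ s (le_of_lt hs)
  obtain ⟨γ₀, hγ₀⟩ := hcusp (s₀ + 1) (by simp)
  have hopen : ∀ γ : SL(2, ℤ), IsOpen {s : ℝ | 1 < (γ • g • imaginaryAxis s).im} := by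
    intro γ
    refine isOpen_lt continuous_const (continuous_im.comp ?_)
    exact (continuous_const_smul (slToReal γ)).comp
      ((continuous_const_smul g).comp continuous_imaginaryAxis)
  -- The second open set collects the horoballs based at all other cusps.
  have hsub : Set.Ioi s₀ ⊆ {s : ℝ | 1 < (γ₀ • g • imaginaryAxis s).im} := by
    refine (isPreconnected_Ioi (a := s₀)).subset_left_of_subset_union (hopen γ₀)
      (v := ⋃ γ ∈ {γ : SL(2, ℤ) | (γ * γ₀⁻¹) 1 0 ≠ 0},
        {s : ℝ | 1 < (γ • g • imaginaryAxis s).im})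
      (isOpen_biUnion fun γ _ => hopen γ) ?_ ?_ ⟨s₀ + 1, by simp, hγ₀⟩
    · refine Set.disjoint_left.2 fun s h1 h2 => ?_
      obtain ⟨γ, hγ, h2⟩ := Set.mem_iUnion₂.1 h2
      refine hγ (eq_zero_of_one_lt_im (τ := γ₀ • g • imaginaryAxis s) h1 ?_)
      rw [mul_smul, inv_smul_smul]
      exact h2
    · intro s hs
      obtain ⟨γ, hγ⟩ := hcusp s hs
      by_cases h : (γ * γ₀⁻¹) 1 0 = 0
      · refine Or.inl ?_
        have := im_smul_eq_of_eq_zero h (γ₀ • g • imaginaryAxis s)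
        rw [mul_smul, inv_smul_smul] at this
        rw [Set.mem_ofPred_eq, ← this]
        exact hγ
      · exact Or.inr (Set.mem_iUnion₂.2 ⟨γ, h, hγ⟩)
  refine ⟨γ₀, by_contra fun hc => ?_⟩
  set c := (slToReal γ₀ * g) 1 0
  have hc2 : 0 < c ^ 2 := by positivity
  -- At this height c²exp(s) ≥ 1, so the image has imaginary part at most 1.
  set s := max (s₀ + 1) (-Real.log (c ^ 2))
  have h1 : 1 < ((slToReal γ₀ * g) • imaginaryAxis s).im := by
    rw [mul_smul]
    exact hsub (lt_of_lt_of_le (by linarith) (le_max_left _ _) : s₀ < s)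
  have h2 := im_smul_mul_le hc (imaginaryAxis s)
  have h3 : 1 ≤ c ^ 2 * (imaginaryAxis s).im := by
    rw [imaginaryAxis_im]
    calc 1 = c ^ 2 * Real.exp (-Real.log (c ^ 2)) := by
          rw [Real.exp_neg, Real.exp_log hc2, mul_inv_cancel₀ hc2.ne']
      _ ≤ c ^ 2 * Real.exp s :=
          mul_le_mul_of_nonneg_left (Real.exp_le_exp.2 (le_max_right _ _)) hc2.le
  nlinarith

/-! ### Affine transformations -/

theorem smul_coe_of_upper_triangular {g : SL(2, ℝ)} (hc : g 1 0 = 0) (τ : ℍ) :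
    ((g • τ : ℍ) : ℂ) = (g 0 0 ^ 2 : ℝ) * τ + (g 0 0 * g 0 1 : ℝ) := by
  have hdet := g.det_coe
  rw [Matrix.det_fin_two, hc, mul_zero, sub_zero] at hdet
  have hdet' : (g 0 0 : ℂ) * g 1 1 = 1 := by exact_mod_cast hdet
  have hd : (g 1 1 : ℂ) ≠ 0 := right_ne_zero_of_mul_eq_one hdet'
  rw [coe_specialLinearGroup_apply, hc]
  simp only [Algebra.algebraMap_self, RingHom.id_apply, Complex.ofReal_zero, zero_mul, zero_add]
  rw [div_eq_iff hd]
  push_cast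
  linear_combination (-(g 0 0 : ℂ) * τ - g 0 1) * hdet'

theorem im_smul_of_upper_triangular {g : SL(2, ℝ)} (hc : g 1 0 = 0) (τ : ℍ) :
    (g • τ).im = g 0 0 ^ 2 * τ.im := by
  have := congrArg Complex.im (smul_coe_of_upper_triangular hc τ)
  rw [Complex.add_im, Complex.ofReal_im, Complex.im_ofReal_mul, add_zero] at this
  exact this

theorem tendsto_smul_of_upper_triangular {g : SL(2, ℝ)} (hc : g 1 0 = 0) :
    Tendsto (fun τ : ℍ => g • τ) atImInfty atImInfty := by
  have hdet := g.det_coe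
  rw [Matrix.det_fin_two, hc, mul_zero, sub_zero] at hdet
  have ha : g 0 0 ≠ 0 := left_ne_zero_of_mul_eq_one hdet
  refine tendsto_comap_iff.2 ?_
  simp only [Function.comp_def, im_smul_of_upper_triangular hc]
  exact tendsto_im_atImInfty.const_mul_atTop (by positivity)

theorem nome_smul_div {g : SL(2, ℝ)} (hc : g 1 0 = 0) (τ : ℍ) : nome (g • τ) / nome τ =
    Complex.exp (Real.pi * Complex.I * ((g 0 0 ^ 2 - 1 : ℝ) * τ + (g 0 0 * g 0 1 : ℝ)) / 2) := by
  rw [nome, nome, ← Complex.exp_sub, smul_coe_of_upper_triangular hc]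
  congr 1
  push_cast
  ring

theorem norm_nome_smul_div {g : SL(2, ℝ)} (hc : g 1 0 = 0) (τ : ℍ) : ‖nome (g • τ) / nome τ‖ =
    Real.exp (-(Real.pi / 2) * (g 0 0 ^ 2 - 1) * τ.im) := by
  rw [norm_div, norm_nome, norm_nome, ← Real.exp_sub, im_smul_of_upper_triangular hc]
  congr 1
  ring

/-- The quotient is an exponential in Im τ, so a nonzero finite limit forces a zero rate. -/
theorem eq_one_of_tendsto_norm_nome {g : SL(2, ℝ)} (hc : g 1 0 = 0) {L : ℝ} (hL : L ≠ 0)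
    (h : Tendsto (fun τ : ℍ => ‖nome (g • τ) / nome τ‖) atImInfty (𝓝 L)) :
    g 0 0 ^ 2 = 1 ∧ L = 1 := by
  simp only [norm_nome_smul_div hc] at h
  obtain ⟨h1, h2⟩ := eq_zero_of_tendsto_exp_mul_im hL h
  refine ⟨?_, h2⟩
  have : Real.pi / 2 ≠ 0 := by positivity
  have := (mul_eq_zero.1 h1).resolve_left (neg_ne_zero.2 this)
  linarith

theorem mk_eq_slToPSL_T_zpow {g : SL(2, ℝ)} (hc : g 1 0 = 0) (ha : g 0 0 ^ 2 = 1) {n : ℤ}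
    (hn : g 0 0 * g 0 1 = n) :
    (QuotientGroup.mk g : PSL(2, ℝ)) = slToPSL (ModularGroup.T ^ n) := by
  have hdet := g.det_coe
  rw [Matrix.det_fin_two, hc, mul_zero, sub_zero] at hdet
  have hT : (slToReal (ModularGroup.T ^ n) : Matrix (Fin 2) (Fin 2) ℝ) = !![1, (n : ℝ); 0, 1] := by
    ext i j
    change ((ModularGroup.T ^ n : SL(2, ℤ)) i j : ℝ) = _
    rw [ModularGroup.coe_T_zpow]
    fin_cases i <;> fin_cases j <;> simp
  change _ = (QuotientGroup.mk (slToReal (ModularGroup.T ^ n)) : PSL(2, ℝ))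
  rcases mul_self_eq_one_iff.1 ((sq _).symm.trans ha) with h | h
  · congr 1
    refine Subtype.ext ?_
    rw [hT, Matrix.eta_fin_two (g : Matrix (Fin 2) (Fin 2) ℝ)]
    rw [h, one_mul] at hdet hn
    rw [h, hn, hc, hdet]
  · refine QuotientGroup.eq.2 (Subgroup.mem_center_iff.2 ?_)
    have : slToReal (ModularGroup.T ^ n) = -g := by
      refine Subtype.ext ?_
      rw [hT, Matrix.SpecialLinearGroup.coe_neg, Matrix.eta_fin_two (-(g : Matrix (Fin 2) (Fin 2) ℝ))]
      rw [h] at hdet hn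
      simp only [Matrix.neg_apply]
      rw [h, hc, ← hn, show g 1 1 = -1 by linarith]
      simp
    rw [this, mul_neg, inv_mul_cancel]
    simp

theorem I_zpow_pow_four (n : ℤ) : (Complex.I ^ n) ^ 4 = 1 := by
  rw [← zpow_natCast, ← zpow_mul, mul_comm, zpow_mul]
  norm_num

theorem burnsideY_sq_T_zpow_smul (n : ℤ) (τ : ℍ) :
    burnsideY (ModularGroup.T ^ n • τ : ℍ) ^ 2 =
      8 * (Complex.I ^ n * (octahedralW τ - octahedralW τ ^ 5)) /
        (1 + Complex.I ^ n * octahedralW τ) ^ 6 := by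
  have h4 := I_zpow_pow_four n
  rw [burnsideY_sq_eq (ModularGroup.T ^ n • τ).im_pos, octahedralW_T_zpow_smul]
  congr 1
  linear_combination -8 * Complex.I ^ n * octahedralW τ ^ 5 * h4

theorem four_dvd_of_I_zpow_eq_one {n : ℤ} (h : Complex.I ^ n = 1) : (4 : ℤ) ∣ n := by
  have h0 : Complex.I ^ (n % 4) = 1 := by
    rw [← h]
    conv_rhs => rw [← Int.emod_add_mul_ediv n 4, zpow_add₀ Complex.I_ne_zero, zpow_mul]
    norm_num
  have h1 := Int.emod_nonneg n four_ne_zero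
  have h2 := Int.emod_lt_of_pos n four_pos
  refine Int.dvd_of_emod_eq_zero ?_
  generalize n % 4 = r at *
  interval_cases r
  · rfl
  · simp [Complex.ext_iff] at h0
  · norm_num at h0
  · rw [show (3 : ℤ) = 2 + 1 by norm_num, zpow_add₀ Complex.I_ne_zero] at h0
    simp [Complex.ext_iff] at h0

/-- The only translation that changes `φ²` by a constant is that by a multiple of `4`. -/
theorem I_zpow_eq_one_of_burnsideY_sq {n : ℤ}
    (h : ∀ τ : ℍ, burnsideY (ModularGroup.T ^ n • τ : ℍ) ^ 2 = Complex.I ^ n * burnsideY τ ^ 2) :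
    Complex.I ^ n = 1 := by
  set ω := Complex.I ^ n with hω
  have hω0 : ω ≠ 0 := zpow_ne_zero _ Complex.I_ne_zero
  -- This is (1 + ωw)⁶ - (1 + w)⁶ divided by w; letting w tend to 0 leaves 6(ω - 1) = 0.
  have key : ∀ τ : ℍ, (ω - 1) * (6 + octahedralW τ * (15 * (ω + 1) + octahedralW τ *
      (20 * (ω ^ 2 + ω + 1) + octahedralW τ * (15 * (ω ^ 3 + ω ^ 2 + ω + 1) + octahedralW τ *
      (6 * (ω ^ 4 + ω ^ 3 + ω ^ 2 + ω + 1) + octahedralW τ *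
      (ω ^ 5 + ω ^ 4 + ω ^ 3 + ω ^ 2 + ω + 1)))))) = 0 := by
    intro τ
    have h1 := h τ
    rw [burnsideY_sq_T_zpow_smul, burnsideY_sq_eq τ.im_pos, ← hω] at h1
    have hd := one_add_octahedralW_ne_zero τ.im_pos
    have hd' : 1 + ω * octahedralW τ ≠ 0 := by
      have := one_add_octahedralW_ne_zero (ModularGroup.T ^ n • τ).im_pos
      rwa [octahedralW_T_zpow_smul] at this
    have h5 : octahedralW τ - octahedralW τ ^ 5 ≠ 0 := by
      have := octahedralW_pow_five_sub_ne_zero τ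
      intro e
      exact this (by linear_combination -e)
    have hw := octahedralW_ne_zero τ.im_pos
    have h2 : (1 + octahedralW τ) ^ 6 = (1 + ω * octahedralW τ) ^ 6 := by
      rw [← mul_div_assoc, div_eq_div_iff (pow_ne_zero 6 hd') (pow_ne_zero 6 hd)] at h1
      refine mul_left_cancel₀ (mul_ne_zero (mul_ne_zero (show (8 : ℂ) ≠ 0 by norm_num) hω0) h5) ?_
      linear_combination h1
    refine mul_left_cancel₀ hw ?_
    linear_combination -h2
  have hw := tendsto_octahedralW
  have hlim := Tendsto.const_mul (ω - 1) (Tendsto.const_add 6 (hw.mul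
    (Tendsto.const_add (15 * (ω + 1)) (hw.mul (Tendsto.const_add (20 * (ω ^ 2 + ω + 1)) (hw.mul
    (Tendsto.const_add (15 * (ω ^ 3 + ω ^ 2 + ω + 1)) (hw.mul
    (Tendsto.const_add (6 * (ω ^ 4 + ω ^ 3 + ω ^ 2 + ω + 1))
      (hw.mul_const (ω ^ 5 + ω ^ 4 + ω ^ 3 + ω ^ 2 + ω + 1)))))))))))
  have := tendsto_nhds_unique (hlim.congr key) tendsto_const_nhds
  rw [zero_mul, add_zero, mul_eq_zero] at this
  rcases this with h | h
  · exact sub_eq_zero.1 h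
  · norm_num at h

/-! ### The automorphism group of `φ` -/

/-- The left side is asymptotic to a unit times 2q(στ), the right to 16q(τ). The ratio of the nomes
would have norm tending to 8, while a finite nonzero limit can only be 1. -/
theorem not_burnsideY_sq_eq_zpow {σ : SL(2, ℝ)} (hc : σ 1 0 = 0) (j : ℤ)
    (h : ∀ τ : ℍ, (-(Complex.I ^ j * octahedralW (σ • τ : ℍ))) ^ 5 -
      -(Complex.I ^ j * octahedralW (σ • τ : ℍ)) = burnsideY τ ^ 2) : False := by
  have hσ := tendsto_smul_of_upper_triangular hc
  have hu := I_zpow_pow_four j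
  have hun : ‖Complex.I ^ j‖ = 1 := by rw [norm_zpow, Complex.norm_I, one_zpow]
  have h1 := (tendsto_octahedralW_div.comp hσ).mul
    ((tendsto_octahedralW.comp hσ).pow 4 |>.const_sub 1)
  have h2 := (tendsto_burnsideY_sq_div.div h1 (by norm_num)).norm
  have e1 : ∀ τ : ℍ, ‖burnsideY τ ^ 2 / nome τ / (octahedralW (σ • τ : ℍ) / nome (σ • τ) *
      (1 - octahedralW (σ • τ : ℍ) ^ 4))‖ = ‖nome (σ • τ) / nome τ‖ := by
    intro τ
    have e : burnsideY τ ^ 2 = Complex.I ^ j * (octahedralW (σ • τ : ℍ) *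
        (1 - octahedralW (σ • τ : ℍ) ^ 4)) := by
      rw [← h]
      linear_combination (-Complex.I ^ j * octahedralW (σ • τ : ℍ) ^ 5) * hu
    have hw : octahedralW (σ • τ : ℍ) * (1 - octahedralW (σ • τ : ℍ) ^ 4) ≠ 0 := by
      intro e'
      rw [e, e', mul_zero] at e
      exact octahedralW_pow_five_sub_ne_zero (σ • τ) (by linear_combination -e')
    have hn := nome_ne_zero τ
    have hn' := nome_ne_zero (σ • τ)
    rw [e, show Complex.I ^ j * (octahedralW (σ • τ : ℍ) * (1 - octahedralW (σ • τ : ℍ) ^ 4)) /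
      nome τ / (octahedralW (σ • τ : ℍ) / nome (σ • τ) * (1 - octahedralW (σ • τ : ℍ) ^ 4)) =
      Complex.I ^ j * (nome (σ • τ) / nome τ) by
        have := left_ne_zero_of_mul hw
        have := right_ne_zero_of_mul hw
        field_simp, norm_mul, hun, one_mul]
  obtain ⟨-, h3⟩ := eq_one_of_tendsto_norm_nome hc (L := ‖(16 / (2 * (1 - 0 ^ 4)) : ℂ)‖)
    (by norm_num) (h2.congr e1)
  norm_num at h3

/-- The left side has a pole at the cusp while y² tends to 0; multiplying by w⁵ turns this into a
nonzero constant tending to 0. -/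
theorem not_burnsideY_sq_eq_zpow_div {σ : SL(2, ℝ)} (hc : σ 1 0 = 0) (j : ℤ)
    (h : ∀ τ : ℍ, (-(Complex.I ^ j / octahedralW (σ • τ : ℍ))) ^ 5 -
      -(Complex.I ^ j / octahedralW (σ • τ : ℍ)) = burnsideY τ ^ 2) : False := by
  have hσ := tendsto_smul_of_upper_triangular hc
  have hw := tendsto_octahedralW.comp hσ
  have h1 := (hw.pow 4).const_mul (Complex.I ^ j) |>.sub (tendsto_burnsideY_sq.mul (hw.pow 5))
  refine zpow_ne_zero j Complex.I_ne_zero (tendsto_nhds_unique (tendsto_const_nhds.congr ?_)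
    (h1.trans_eq ?_))
  · intro τ
    have h0 := octahedralW_ne_zero (σ • τ).im_pos
    simp only [Function.comp_apply]
    rw [← h τ]
    field_simp
    linear_combination -I_zpow_pow_four j
  · norm_num

/-- Both sides have leading coefficient 16 in their nomes, so the modulus of the nome ratio gives a²
= 1 and its phase determines the translation length. -/
theorem upper_triangular_of_burnsideY_sq {σ : SL(2, ℝ)} (hc : σ 1 0 = 0) (j : ℤ)
    (h : ∀ τ : ℍ, Complex.I ^ j * burnsideY (σ • τ : ℍ) ^ 2 = burnsideY τ ^ 2) :
    σ 0 0 ^ 2 = 1 ∧ ∃ n : ℤ, σ 0 0 * σ 0 1 = n ∧ Complex.I ^ j * Complex.I ^ n = 1 := by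
  have hσ := tendsto_smul_of_upper_triangular hc
  have hun : ‖Complex.I ^ j‖ = 1 := by rw [norm_zpow, Complex.norm_I, one_zpow]
  have h1 := tendsto_burnsideY_sq_div.div (tendsto_burnsideY_sq_div.comp hσ) (by norm_num)
  have e : ∀ τ : ℍ, burnsideY τ ^ 2 / nome τ / (burnsideY (σ • τ : ℍ) ^ 2 / nome (σ • τ)) =
      Complex.I ^ j * (nome (σ • τ) / nome τ) := by
    intro τ
    have := burnsideY_ne_zero (σ • τ).im_pos
    have hn := nome_ne_zero τ
    have hn' := nome_ne_zero (σ • τ)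
    rw [← h]
    field_simp
  replace h1 := h1.congr e
  obtain ⟨h2, -⟩ := eq_one_of_tendsto_norm_nome hc (L := ‖(16 / 16 : ℂ)‖) (by norm_num)
    (h1.norm.congr fun τ => by rw [norm_mul, hun, one_mul])
  refine ⟨h2, ?_⟩
  set b := σ 0 0 * σ 0 1
  have h3 : Complex.I ^ j * Complex.exp (Real.pi * Complex.I * b / 2) = 1 := by
    rw [← div_self (show (16 : ℂ) ≠ 0 by norm_num)]
    refine tendsto_nhds_unique (tendsto_const_nhds.congr fun τ => ?_) h1
    rw [nome_smul_div hc, h2, sub_self, Complex.ofReal_zero, zero_mul, zero_add]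
  -- The fourth power removes the unknown root of unity and shows that b is an integer.
  have h4 : Complex.exp (2 * Real.pi * Complex.I * b) = 1 := by
    have := congrArg (· ^ 4) h3
    simp only [mul_pow, I_zpow_pow_four, one_mul, one_pow, ← Complex.exp_nat_mul] at this
    rw [← this]
    congr 1
    push_cast
    ring
  obtain ⟨n, hn⟩ := Complex.exp_eq_one_iff.1 h4
  have hb : (b : ℂ) = n := by
    refine mul_left_cancel₀ Complex.two_pi_I_ne_zero ?_
    linear_combination hn
  refine ⟨n, by exact_mod_cast hb, ?_⟩
  rw [← h3, hb, show (Real.pi * Complex.I * n / 2 : ℂ) = n * (Real.pi / 2 * Complex.I) by ring,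
    Complex.exp_int_mul, Complex.exp_pi_div_two_mul_I]

theorem S_inv_mul_mul_S_mem {γ : SL(2, ℤ)} (h : γ ∈ pmGammaFour) :
    ModularGroup.S⁻¹ * γ * ModularGroup.S ∈ pmGammaFour := by
  obtain ⟨h1, h2⟩ := h
  constructor
  · rw [sl_mul_apply, sl_mul_apply, sl_mul_apply, Matrix.SpecialLinearGroup.SL2_inv_expl]
    simpa [ModularGroup.S] using h2
  · rw [sl_mul_apply, sl_mul_apply, sl_mul_apply, Matrix.SpecialLinearGroup.SL2_inv_expl]
    simpa [ModularGroup.S] using h1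

theorem T_zpow_mem_pmGammaFour {n : ℤ} (h : (4 : ℤ) ∣ n) : ModularGroup.T ^ n ∈ pmGammaFour := by
  constructor <;> rw [ModularGroup.coe_T_zpow] <;> simp [h]

theorem slToPSL_mem_of_conj_mem {γ h : SL(2, ℤ)} {j k n : ℤ} (hh : h ∈ pmGammaFour)
    (hj : 4 ∣ j) (hn : 4 ∣ n) (e : ModularGroup.S * γ⁻¹ =
      h * ModularGroup.T ^ j * ModularGroup.S * ModularGroup.T ^ k) :
    slToPSL (γ⁻¹ * ModularGroup.T ^ (-k) * ModularGroup.T ^ n) ∈ gammaFour := by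
  have e' : γ⁻¹ * ModularGroup.T ^ (-k) =
      ModularGroup.S⁻¹ * (h * ModularGroup.T ^ j) * ModularGroup.S := by
    rw [← inv_mul_cancel_left ModularGroup.S γ⁻¹, e]
    group
  rw [e']
  exact slToPSL_mem_of_mem_pmGammaFour (mul_mem
    (S_inv_mul_mul_S_mem (mul_mem hh (T_zpow_mem_pmGammaFour hj))) (T_zpow_mem_pmGammaFour hn))

theorem octahedralW_S_T_two_S_smul (τ : ℍ) : octahedralW
    ((ModularGroup.S * ModularGroup.T ^ (2 : ℤ) * ModularGroup.S) • τ : ℍ) =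
      (octahedralW τ)⁻¹ := by
  rw [mul_smul, mul_smul]
  have h1 := one_add_octahedralW_ne_zero
    (ModularGroup.T ^ (2 : ℤ) • ModularGroup.S • τ : ℍ).im_pos
  rw [octahedralW_S_smul]
  rw [octahedralW_T_zpow_smul, octahedralW_S_smul,
    show Complex.I ^ (2 : ℤ) = -1 from Complex.I_sq] at h1 ⊢
  have h2 := one_add_octahedralW_ne_zero τ.im_pos
  have h3 := octahedralW_ne_zero τ.im_pos
  rw [div_eq_iff h1]
  field_simp
  ring

/-- With σ = γg fixing ∞, x ∘ g equals -w ∘ (Sγ⁻¹σ), so the coset of Sγ⁻¹ decides the limit of x ∘ g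
at i∞. Only the limits at fourth roots of unity are compatible with y ∘ g = y. -/
theorem automorphismGroup_burnsideY_le :
    automorphismGroup (fun τ : ℍ => burnsideY τ) ≤ gammaFour := by
  intro g hg
  induction g using QuotientGroup.induction_on with | H g => ?_
  replace hg : ∀ τ : ℍ, burnsideY (g • τ : ℍ) = burnsideY τ := hg
  obtain ⟨γ, hγ⟩ := exists_upper_triangular hg
  obtain ⟨σ, hσ⟩ : ∃ σ, σ = slToReal γ * g := ⟨_, rfl⟩
  rw [← hσ] at hγ
  have hX : ∀ τ : ℍ, burnsideX (g • τ : ℍ) =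
      -octahedralW ((ModularGroup.S * γ⁻¹) • σ • τ : ℍ) := by
    intro τ
    rw [burnsideX_eq_neg_octahedralW, mul_smul, hσ, mul_smul, slToReal_smul, inv_smul_smul]
  have hY : ∀ τ : ℍ, burnsideX (g • τ : ℍ) ^ 5 - burnsideX (g • τ : ℍ) = burnsideY τ ^ 2 := by
    intro τ
    rw [← burnsideY_sq (g • τ).im_pos, hg]
  obtain ⟨h, hh, j, e | ⟨k, e⟩ | e⟩ := sl2z_cases (ModularGroup.S * γ⁻¹)
  · refine (not_burnsideY_sq_eq_zpow hγ j fun τ => ?_).elim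
    rw [← hY, hX, e, mul_smul h, octahedralW_pmGammaFour_smul hh, octahedralW_T_zpow_smul]
  -- Absorbing `T ^ k` gives x ∘ g = iʲ (x ∘ ρ), and x⁵ - x scales by the same iʲ; hence y² = iʲ (y²
  -- ∘ ρ).
  · obtain ⟨ρ, hρ⟩ : ∃ ρ, ρ = slToReal (ModularGroup.T ^ k) * σ := ⟨_, rfl⟩
    have hρ0 : ρ 1 0 = 0 := by
      rw [hρ]
      change ((slToReal (ModularGroup.T ^ k) : Matrix (Fin 2) (Fin 2) ℝ) *
        (σ : Matrix (Fin 2) (Fin 2) ℝ)) 1 0 = 0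
      rw [Matrix.mul_apply, Fin.sum_univ_two, hγ, mul_zero, add_zero, slToReal_apply,
        ModularGroup.coe_T_zpow]
      simp
    have hXρ : ∀ τ : ℍ, burnsideX (g • τ : ℍ) = Complex.I ^ j * burnsideX (ρ • τ : ℍ) := by
      intro τ
      rw [hX, e, mul_smul, mul_smul, mul_smul, octahedralW_pmGammaFour_smul hh,
        octahedralW_T_zpow_smul, burnsideX_eq_neg_octahedralW, hρ, mul_smul, slToReal_smul,
        mul_neg]
    obtain ⟨ha, n, hn, hu⟩ := upper_triangular_of_burnsideY_sq hρ0 j fun τ => by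
      rw [← hY τ, hXρ, burnsideY_sq (ρ • τ).im_pos]
      linear_combination (-(Complex.I ^ j * burnsideX (ρ • τ : ℍ) ^ 5)) * I_zpow_pow_four j
    have hmk := mk_eq_slToPSL_T_zpow hρ0 ha hn
    -- The leading terms only give 4 ∣ j + n; the next term in w separates this into 4 ∣ n and 4 ∣
    -- j.
    have hI : Complex.I ^ n = 1 := I_zpow_eq_one_of_burnsideY_sq fun τ => by
      have h1 : ModularGroup.T ^ n • τ = ρ • τ := by
        rw [← slToPSL_smul, ← hmk, psl_mk_smul]
      rw [h1, ← hY τ, hXρ, burnsideY_sq (ρ • τ).im_pos]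
      linear_combination (-(Complex.I ^ n * Complex.I ^ j * burnsideX (ρ • τ : ℍ) ^ 5)) *
        I_zpow_pow_four j - (burnsideX (ρ • τ : ℍ) ^ 5 - burnsideX (ρ • τ : ℍ)) * hu
    rw [hI, mul_one] at hu
    have := slToPSL_mem_of_conj_mem hh (four_dvd_of_I_zpow_eq_one hu)
      (four_dvd_of_I_zpow_eq_one hI) e
    rw [map_mul, ← hmk] at this
    convert this using 1
    change (QuotientGroup.mk g : PSL(2, ℝ)) =
      QuotientGroup.mk (slToReal (γ⁻¹ * ModularGroup.T ^ (-k)) * ρ)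
    congr 1
    rw [hρ, hσ, map_mul, map_inv, zpow_neg, map_inv]
    group
  · refine (not_burnsideY_sq_eq_zpow_div hγ j fun τ => ?_).elim
    rw [← hY, hX, e, mul_assoc, mul_assoc, mul_smul (h * _), mul_smul h,
      octahedralW_pmGammaFour_smul hh, octahedralW_T_zpow_smul, ← mul_assoc,
      octahedralW_S_T_two_S_smul, div_eq_mul_inv]

theorem automorphismGroup_burnsideY_eq :
    automorphismGroup (fun τ : ℍ => burnsideY τ) = Subgroup.closure (Set.range genT) := by
  rw [← automorphismGroup_burnsideY_inf_gammaFour]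
  exact (inf_eq_left.2 automorphismGroup_burnsideY_le).symm

theorem burnsideGroup_eq : burnsideGroup = Subgroup.closure (Set.range genT) := by
  rw [← automorphismGroup_burnsideY_eq, burnsideGroup, inf_eq_right]
  exact automorphismGroup_burnsideY_le.trans gammaFour_le_automorphismGroup_burnsideX

end Cusp

/-! ### Assembly of the theorem -/

theorem mainTheorem2 :
    -- `x = χ(τ)`, `y = φ(τ)` are holomorphic on `ℍ` and parametrize the curve `y² = x⁵ - x`
    (DifferentiableOn ℂ burnsideX {τ | 0 < τ.im} ∧ DifferentiableOn ℂ burnsideY {τ | 0 < τ.im} ∧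
      ∀ τ : ℍ, burnsideY τ ^ 2 = burnsideX τ ^ 5 - burnsideX τ) ∧
    -- `V₀, …, V₄` are free generators of `Γ(4)`
    FreelyGenerates genV gammaFour ∧
    -- the matrices `T₀, …, T₈` in terms of `V₀, …, V₄`
    (genT 0 = genV 0 * genV 0 ∧
      genT 1 = genV 0 * genV 1 ∧ genT 5 = genV 0 * (genV 1)⁻¹ ∧
      genT 2 = genV 0 * genV 2 ∧ genT 6 = genV 0 * (genV 2)⁻¹ ∧
      genT 3 = genV 0 * genV 3 ∧ genT 7 = genV 0 * (genV 3)⁻¹ ∧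
      genT 4 = genV 0 * genV 4 ∧ genT 8 = genV 0 * (genV 4)⁻¹) ∧
    -- the uniformizing group is a subgroup of index 2 in `Γ(4)`, free on the nine generators
    burnsideGroup ≤ gammaFour ∧ burnsideGroup.relIndex gammaFour = 2 ∧
    FreelyGenerates genT burnsideGroup ∧
    -- it coincides with the automorphism group of `φ`
    automorphismGroup (fun τ : ℍ => burnsideY τ) = burnsideGroup ∧
    -- the 18-gon is a fundamental region; it consists of two copies of a 10-gon
    IsFundamentalRegion burnsideGroup eighteenGon ∧
    eighteenGon = tenGon ∪ genV 0 • tenGon ∧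
    -- the generators identify its 18 sides in pairs
    genT 0 • geodesicRay (-1 / 2) = geodesicRay (15 / 2) ∧
    (genT 1 • arcSide 1 = arcSide 8 ∧ genT 5 • arcSide 0 = arcSide 9 ∧
      genT 2 • arcSide 3 = arcSide 10 ∧ genT 6 • arcSide 2 = arcSide 11 ∧
      genT 3 • arcSide 5 = arcSide 12 ∧ genT 7 • arcSide 4 = arcSide 13 ∧
      genT 4 • arcSide 7 = arcSide 14 ∧ genT 8 • arcSide 6 = arcSide 15) := by
  have hle : burnsideGroup ≤ gammaFour := inf_le_right.trans automorphismGroup_burnsideY_le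
  refine ⟨⟨fun τ hτ => (differentiableAt_burnsideX hτ).differentiableWithinAt,
      fun τ hτ => (differentiableAt_burnsideY hτ).differentiableWithinAt,
      fun τ => burnsideY_sq τ.im_pos⟩,
    freelyGenerates_genV, genT_eq, hle, ?_, ⟨lift_genT_injective, burnsideGroup_eq.symm⟩, ?_, ?_,
    eighteenGon_eq_union, genT_zero_smul_geodesicRay, genT_smul_arcSide⟩
  · rw [burnsideGroup_eq]
    exact relIndex_closure_range_genT
  · rw [burnsideGroup_eq, automorphismGroup_burnsideY_eq]
  · rw [burnsideGroup_eq]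
    exact isFundamentalRegion_eighteenGon
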